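/- Let $k$ be an algebraically closed field of characteristic zero, and let $\mathrm{Ch}(k)$ be the category of (unbounded, homologically graded) chain complexes of $k$-vector spaces, with its usual tensor product and the braiding $x\otimes y\mapsto(-1)^{|x||y|}\,y\otimes x$. Let $P$ be a symmetric operad in $\mathrm{Ch}(k)$. A $P$-cogebra is a complex $V$ together with a morphism of operads from $P$ to the coendomorphism operad $\bigl([V,V^{\otimes n}]\bigr)_{n\ge 0}$ of $V$, that is, with chain maps $P(n)\otimes V\to V^{\otimes n}$, $n\ge 0$, compatible with the actions of the symmetric groups, the unit and the compositions; a morphism of $P$-cogebras is a chain map that commutes with these structure maps. In the category of $P$-cogebras let * $W$ be the class of morphisms whose underlying chain map is a quasi-isomorphism, * $C$ be the class of morphisms whose underlying chain map is a monomorphism in each degree, * $F$ be the class of morphisms with the right lifting property against $C\cap W$. The operad $P$ is called coadmissible if the category of $P$-cogebras, with $W$, $C$ and $F$ as weak equivalences, cofibrations and fibrations, is a model category. **Proposition.** The commutative operad is not coadmissible in $\mathrm{Ch}(k)$. This holds both for the operad of unital commutative algebras ($\mathrm{Com}(n)=k$, concentrated in degree $0$ with trivial action of the symmetric group, for all $n\ge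 0$; its cogebras are the counital cocommutative dg cogebras) and for the operad of non-unital commutative algebras ($\mathrm{Com}(0)=0$ and $\mathrm{Com}(n)=k$ for all $n\ge 1$; its cogebras are the cocommutative dg cogebras that need not have a counit). -/

import Mathlib

open CategoryTheory MonoidalCategory Limits

universe v u

set_option linter.unusedSectionVars false

namespace DG

/-- The Koszul signs `(-1)^p` for homologically graded complexes. -/
instance tensorSignsDown : ComplexShape.TensorSigns (ComplexShape.down ℤ) where
  ε' := MonoidHom.mk' (fun i : Multiplicative ℤ => Int.negOnePow (Multiplicative.toAdd i))
    (fun a b => Int.negOnePow_add (Multiplicative.toAdd a) (Multiplicative.toAdd b))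
  rel_add p q r h := by
    simp only [ComplexShape.down_Rel] at h ⊢; omega
  add_rel p q r h := by
    simp only [ComplexShape.down_Rel] at h ⊢; omega
  ε'_succ p q h := by
    simp only [ComplexShape.down_Rel] at h
    subst h
    show Int.negOnePow q = - Int.negOnePow (q + 1)
    rw [Int.negOnePow_succ, neg_neg]

section Signed
open GradedObject GradedObject.Monoidal

variable {C : Type u} [Category.{v} C] [Preadditive C] [MonoidalCategory C]
  [MonoidalPreadditive C]

lemma whiskerRight_neg' {X Y : C} (f : X ⟶ Y) (Z : C) : (-f) ▷ Z = -(f ▷ Z) := by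
  have h := MonoidalPreadditive.add_whiskerRight (X := Z) (-f) f
  rw [neg_add_cancel, MonoidalPreadditive.zero_whiskerRight] at h
  exact eq_neg_of_add_eq_zero_left h.symm

lemma whiskerLeft_neg' {X Y : C} (f : X ⟶ Y) (Z : C) : Z ◁ (-f) = -(Z ◁ f) := by
  have h := MonoidalPreadditive.whiskerLeft_add (X := Z) (-f) f
  rw [neg_add_cancel, MonoidalPreadditive.whiskerLeft_zero] at h
  exact eq_neg_of_add_eq_zero_left h.symm

lemma units_smul_whiskerRight (s : ℤˣ) {X Y : C} (f : X ⟶ Y) (Z : C) :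
    (s • f) ▷ Z = s • (f ▷ Z) := by
  rcases Int.units_eq_one_or s with rfl | rfl 
  · simp
  · simp [Units.smul_def, whiskerRight_neg']

lemma whiskerLeft_units_smul (s : ℤˣ) {X Y : C} (f : X ⟶ Y) (Z : C) :
    Z ◁ (s • f) = s • (Z ◁ f) := by
  rcases Int.units_eq_one_or s with rfl | rfl 
  · simp
  · simp [Units.smul_def, whiskerLeft_neg']

variable [SymmetricCategory C] (X Y Z : GradedObject ℤ C)

/-- The braiding `x ⊗ y ↦ (-1)^{ij} y ⊗ x`, for `x` of degree `i` and `y` of degree `j`,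
on the tensor product of graded objects. -/
noncomputable def signedHom [HasTensor X Y] [HasTensor Y X] :
    GradedObject.Monoidal.tensorObj X Y ⟶ GradedObject.Monoidal.tensorObj Y X := fun k =>
  tensorObjDesc (fun i j hij => (i * j).negOnePow • ((β_ (X i) (Y j)).hom ≫
    ιTensorObj Y X j i k (by rw [add_comm]; exact hij)))

lemma ι_signedHom [HasTensor X Y] [HasTensor Y X] (i j k : ℤ) (h : i + j = k) :
    ιTensorObj X Y i j k h ≫ signedHom X Y k = (i * j).negOnePow • ((β_ (X i) (Y j)).hom ≫
      ιTensorObj Y X j i k (by rw [add_comm]; exact h)) := by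
  simp [signedHom]

lemma signed_symm [HasTensor X Y] [HasTensor Y X] : signedHom X Y ≫ signedHom Y X = 𝟙 _ := by
  ext k : 1
  apply tensorObj_ext
  intro i j h
  show ιTensorObj X Y i j k h ≫ signedHom X Y k ≫ signedHom Y X k = _ ≫ 𝟙 _
  rw [← Category.assoc, ι_signedHom]
  simp [ι_signedHom, smul_smul, mul_comm j i]


lemma signed_nat_left {X Y : GradedObject ℤ C} (f : X ⟶ Y) [HasTensor X Z] [HasTensor Z X]
    [HasTensor Y Z] [HasTensor Z Y] :
    GradedObject.Monoidal.tensorHom f (𝟙 Z) ≫ signedHom Y Z =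
      signedHom X Z ≫ GradedObject.Monoidal.tensorHom (𝟙 Z) f := by
  ext k : 1
  apply tensorObj_ext
  intro i j h
  show ιTensorObj X Z i j k h ≫ GradedObject.Monoidal.tensorHom f (𝟙 Z) k ≫ signedHom Y Z k =
    ιTensorObj X Z i j k h ≫ signedHom X Z k ≫ GradedObject.Monoidal.tensorHom (𝟙 Z) f k
  rw [ι_tensorHom_assoc, ← Category.assoc (ιTensorObj X Z i j k h), ι_signedHom, ι_signedHom,
    Linear.comp_units_smul,
    Linear.units_smul_comp, Category.assoc, ι_tensorHom, BraidedCategory.braiding_naturality_assoc]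

lemma signed_hexagon [HasTensor X Y] [HasTensor Y X] [HasTensor Y Z]
    [HasTensor Z X] [HasTensor X Z]
    [HasTensor (tensorObj X Y) Z] [HasTensor X (tensorObj Y Z)]
    [HasTensor (tensorObj Y Z) X] [HasTensor Y (tensorObj Z X)]
    [HasTensor (tensorObj Y X) Z] [HasTensor Y (tensorObj X Z)]
    [HasGoodTensor₁₂Tensor X Y Z] [HasGoodTensorTensor₂₃ X Y Z]
    [HasGoodTensor₁₂Tensor Y Z X] [HasGoodTensorTensor₂₃ Y Z X]
    [HasGoodTensor₁₂Tensor Y X Z] [HasGoodTensorTensor₂₃ Y X Z] :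
    (GradedObject.Monoidal.associator X Y Z).hom ≫ signedHom X (tensorObj Y Z) ≫
        (GradedObject.Monoidal.associator Y Z X).hom =
      GradedObject.Monoidal.tensorHom (signedHom X Y) (𝟙 Z) ≫
        (GradedObject.Monoidal.associator Y X Z).hom ≫
        GradedObject.Monoidal.tensorHom (𝟙 Y) (signedHom X Z) := by
  ext k : 1
  apply tensorObj₃'_ext
  intro i₁ i₂ i₃ h
  have e : (i₁ * (i₂ + i₃)).negOnePow = (i₁ * i₂).negOnePow * (i₁ * i₃).negOnePow := by
    rw [mul_add, Int.negOnePow_add]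
  show _ ≫ (GradedObject.Monoidal.associator X Y Z).hom k ≫ signedHom X (tensorObj Y Z) k ≫
        (GradedObject.Monoidal.associator Y Z X).hom k =
      _ ≫ GradedObject.Monoidal.tensorHom (signedHom X Y) (𝟙 Z) k ≫
        (GradedObject.Monoidal.associator Y X Z).hom k ≫
        GradedObject.Monoidal.tensorHom (𝟙 Y) (signedHom X Z) k
  trans ((i₁ * i₂).negOnePow * (i₁ * i₃).negOnePow) •
    (((β_ (X i₁) (Y i₂)).hom ▷ Z i₃) ≫ (α_ _ _ _).hom ≫ (Y i₂ ◁ (β_ (X i₁) (Z i₃)).hom) ≫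
      ιTensorObj₃ Y Z X i₂ i₃ i₁ k (by rw [add_comm _ i₁, ← add_assoc, h]))
  · rw [ιTensorObj₃'_associator_hom_assoc, ιTensorObj₃_eq X Y Z i₁ i₂ i₃ k h _ rfl,
      Category.assoc,
      ← Category.assoc (ιTensorObj X _ i₁ _ k _), ι_signedHom, Linear.units_smul_comp, Linear.comp_units_smul,
      Linear.comp_units_smul, e]
    congr 1
    rw [Category.assoc, ← MonoidalCategory.id_tensorHom,
      BraidedCategory.braiding_naturality_assoc,
      BraidedCategory.braiding_tensor_right_hom, Category.assoc, Category.assoc, Category.assoc,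
      Category.assoc, Iso.hom_inv_id_assoc, MonoidalCategory.tensorHom_id,
      ← ιTensorObj₃'_eq_assoc Y Z X i₂ i₃ i₁ k (by rw [add_comm _ i₁, ← add_assoc, h]) _ rfl,
      ιTensorObj₃'_associator_hom, Iso.inv_hom_id_assoc]
  · rw [ιTensorObj₃'_eq X Y Z i₁ i₂ i₃ k h _ rfl, Category.assoc, ι_tensorHom_assoc,
      categoryOfGradedObjects_id, MonoidalCategory.tensorHom_id,
      ← MonoidalCategory.comp_whiskerRight_assoc, ι_signedHom, units_smul_whiskerRight,
      MonoidalCategory.comp_whiskerRight, Linear.units_smul_comp, Category.assoc]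
    rw [← ιTensorObj₃'_eq_assoc Y X Z i₂ i₁ i₃ k
      (by rw [add_comm i₂ i₁, h]) (i₁ + i₂) (add_comm i₂ i₁),
      ιTensorObj₃'_associator_hom_assoc,
      ιTensorObj₃_eq Y X Z i₂ i₁ i₃ k (by rw [add_comm i₂ i₁, h]) _ rfl, Category.assoc,
      ι_tensorHom, categoryOfGradedObjects_id, MonoidalCategory.id_tensorHom,
      ← MonoidalCategory.whiskerLeft_comp_assoc, ι_signedHom, whiskerLeft_units_smul,
      MonoidalCategory.whiskerLeft_comp, Linear.units_smul_comp, Linear.comp_units_smul,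
      Linear.comp_units_smul, smul_smul, Category.assoc,
      ← ιTensorObj₃_eq Y Z X i₂ i₃ i₁ k (by rw [add_comm _ i₁, ← add_assoc, h])
      (i₁ + i₃) (add_comm _ _)]

lemma signed_nat_right {X Y : GradedObject ℤ C} (f : X ⟶ Y) [HasTensor X Z] [HasTensor Z X]
    [HasTensor Y Z] [HasTensor Z Y] :
    GradedObject.Monoidal.tensorHom (𝟙 Z) f ≫ signedHom Z Y =
      signedHom Z X ≫ GradedObject.Monoidal.tensorHom f (𝟙 Z) := by
  rw [← Category.comp_id (_ ≫ signedHom Z Y), ← Category.id_comp (_ ≫ signedHom Z Y)]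
  rw [← signed_symm Z X]
  simp only [Category.assoc]
  rw [← Category.assoc (signedHom X Z), ← signed_nat_left, Category.assoc, Category.comp_id,
    signed_symm, Category.comp_id]

lemma signed_hexagon_reverse [HasTensor X Y] [HasTensor Y Z] [HasTensor Z X]
    [HasTensor Z Y] [HasTensor X Z]
    [HasTensor (tensorObj X Y) Z] [HasTensor X (tensorObj Y Z)]
    [HasTensor Z (tensorObj X Y)] [HasTensor (tensorObj Z X) Y]
    [HasTensor X (tensorObj Z Y)] [HasTensor (tensorObj X Z) Y]
    [HasGoodTensor₁₂Tensor X Y Z] [HasGoodTensorTensor₂₃ X Y Z]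
    [HasGoodTensor₁₂Tensor Z X Y] [HasGoodTensorTensor₂₃ Z X Y]
    [HasGoodTensor₁₂Tensor X Z Y] [HasGoodTensorTensor₂₃ X Z Y] :
    (GradedObject.Monoidal.associator X Y Z).inv ≫ signedHom (tensorObj X Y) Z ≫
        (GradedObject.Monoidal.associator Z X Y).inv =
      GradedObject.Monoidal.tensorHom (𝟙 X) (signedHom Y Z) ≫
        (GradedObject.Monoidal.associator X Z Y).inv ≫
        GradedObject.Monoidal.tensorHom (signedHom X Z) (𝟙 Y) := by
  have h2 : GradedObject.Monoidal.tensorHom (signedHom Z X) (𝟙 Y) ≫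
      GradedObject.Monoidal.tensorHom (signedHom X Z) (𝟙 Y) = 𝟙 _ := by
    rw [GradedObject.Monoidal.tensorHom_comp_tensorHom, signed_symm, Category.comp_id,
      GradedObject.Monoidal.id_tensorHom_id]
  have H := signed_hexagon Z X Y
  have A : (((GradedObject.Monoidal.associator X Y Z).inv ≫ signedHom (tensorObj X Y) Z ≫
        (GradedObject.Monoidal.associator Z X Y).inv)) ≫ 
       ((GradedObject.Monoidal.associator Z X Y).hom ≫ signedHom Z (tensorObj X Y) ≫
        (GradedObject.Monoidal.associator X Y Z).hom) = 𝟙 _ := by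
    simp only [Category.assoc, Iso.inv_hom_id_assoc]
    rw [← Category.assoc (signedHom _ _), signed_symm, Category.id_comp, Iso.inv_hom_id]
  have B : (GradedObject.Monoidal.tensorHom (signedHom Z X) (𝟙 Y) ≫
        (GradedObject.Monoidal.associator X Z Y).hom ≫
        GradedObject.Monoidal.tensorHom (𝟙 X) (signedHom Z Y)) ≫ 
      (GradedObject.Monoidal.tensorHom (𝟙 X) (signedHom Y Z) ≫
        (GradedObject.Monoidal.associator X Z Y).inv ≫
        GradedObject.Monoidal.tensorHom (signedHom X Z) (𝟙 Y)) = 𝟙 _ := by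
    have h1' : GradedObject.Monoidal.tensorHom (𝟙 X) (signedHom Z Y) ≫
      GradedObject.Monoidal.tensorHom (𝟙 X) (signedHom Y Z) = 𝟙 _ := by
      rw [GradedObject.Monoidal.tensorHom_comp_tensorHom, signed_symm, Category.comp_id,
      GradedObject.Monoidal.id_tensorHom_id]
    simp only [Category.assoc]
    rw [← Category.assoc (GradedObject.Monoidal.tensorHom (𝟙 X) (signedHom Z Y)), h1',
      Category.id_comp, Iso.hom_inv_id_assoc, h2]
  rw [← Category.comp_id (_ ≫ signedHom (tensorObj X Y) Z ≫ _), ← B, ← Category.assoc, ← H, A,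
    Category.id_comp]

end Signed

section Cx
variable (k : Type u) [Field k]

/-- The category of (unbounded, homologically graded) chain complexes over the field `k`. -/
abbrev Ch := ChainComplex (ModuleCat.{u} k) ℤ

variable {k}

lemma ι_d (K L : Ch k) (i j p q : ℤ) (h : p + q = i) (hij : j + 1 = i) :
    HomologicalComplex.ιTensorObj K L p q i h ≫ (HomologicalComplex.tensorObj K L).d i j =
      (K.d p (p - 1) ▷ L.X q) ≫ HomologicalComplex.ιTensorObj K L (p - 1) q j (by omega) +
      p.negOnePow • ((K.X p ◁ L.d q (q - 1)) ≫
        HomologicalComplex.ιTensorObj K L p (q - 1) j (by omega)) := by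
  have hp : (ComplexShape.down ℤ).Rel p (p - 1) := by simp
  have hq : (ComplexShape.down ℤ).Rel q (q - 1) := by simp
  rw [HomologicalComplex.mapBifunctor.d_eq, Preadditive.comp_add,
    HomologicalComplex.mapBifunctor.ι_D₁, HomologicalComplex.mapBifunctor.ι_D₂,
    HomologicalComplex.mapBifunctor.d₁_eq _ _ _ _ hp _ _ (by show p - 1 + q = j; omega),
    HomologicalComplex.mapBifunctor.d₂_eq _ _ _ _ _ hq _ (by show p + (q - 1) = j; omega)]
  congr 1
  exact one_smul _ _

lemma ι_braid (K L : Ch k) (p q i : ℤ) (h : p + q = i) :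
    HomologicalComplex.ιTensorObj K L p q i h ≫
      (show (HomologicalComplex.tensorObj K L).X i ⟶ (HomologicalComplex.tensorObj L K).X i from
        signedHom K.X L.X i) = (p * q).negOnePow • ((β_ (K.X p) (L.X q)).hom ≫
      HomologicalComplex.ιTensorObj L K q p i (by omega)) :=
  ι_signedHom K.X L.X p q i h

lemma signed_comm (K L : Ch k) (i j : ℤ) (hij : (ComplexShape.down ℤ).Rel i j) :
    (show (HomologicalComplex.tensorObj K L).X i ⟶ (HomologicalComplex.tensorObj L K).X i from
        signedHom K.X L.X i) ≫ (HomologicalComplex.tensorObj L K).d i j =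
      (HomologicalComplex.tensorObj K L).d i j ≫
      (show (HomologicalComplex.tensorObj K L).X j ⟶ (HomologicalComplex.tensorObj L K).X j from
        signedHom K.X L.X j) := by
  rw [ComplexShape.down_Rel] at hij
  apply HomologicalComplex.mapBifunctor.hom_ext
  intro p q h
  replace h : p + q = i := h
  change HomologicalComplex.ιTensorObj K L p q i h ≫ _ = HomologicalComplex.ιTensorObj K L p q i h ≫ _
  have e1 : ((p - 1) * q).negOnePow = (p * q).negOnePow * q.negOnePow := by
    rw [sub_mul, one_mul, Int.negOnePow_sub]
  have e2 : p.negOnePow * (p * (q - 1)).negOnePow = (p * q).negOnePow := by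
    rw [← Int.negOnePow_add]; congr 1; ring
  rw [← Category.assoc, ← Category.assoc, ι_braid, ι_d _ _ _ _ _ _ _ hij, Linear.units_smul_comp,
    Category.assoc, ι_d _ _ _ _ _ _ _ hij, Preadditive.add_comp, Linear.units_smul_comp,
    Category.assoc, Category.assoc, ι_braid, ι_braid]
  simp only [Preadditive.comp_add, smul_add, Linear.comp_units_smul, smul_smul, e1, e2]
  rw [add_comm]
  congr 1
  · simp
  · simp

/-- The braiding with Koszul signs on chain complexes. -/
noncomputable def braid (K L : Ch k) : K ⊗ L ⟶ L ⊗ K where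
  f := signedHom K.X L.X
  comm' i j h := signed_comm K L i j h

/-- The symmetric monoidal structure on chain complexes: Mathlib's tensor product of complexes,
and the braiding with Koszul signs. -/
noncomputable instance chSymmetric : SymmetricCategory (Ch k) where
  braiding K L := { 
    hom := braid K L
    inv := braid L K
    hom_inv_id := by 
      ext j : 1
      exact congrFun (signed_symm K.X L.X) j
    inv_hom_id := by 
      ext j : 1
      exact congrFun (signed_symm L.X K.X) j }
  braiding_naturality_left f Z := by
    ext j : 1
    exact congrFun (signed_nat_left Z.X f.f) j
  braiding_naturality_right Z _ _ f := by
    ext j : 1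
    exact congrFun (signed_nat_right Z.X f.f) j
  hexagon_forward X Y Z := by
    ext j : 1
    exact congrFun (signed_hexagon X.X Y.X Z.X) j
  hexagon_reverse X Y Z := by
    ext j : 1
    exact congrFun (signed_hexagon_reverse X.X Y.X Z.X) j
  symmetry K L := by
    ext j : 1
    exact congrFun (signed_symm K.X L.X) j

lemma ι_whiskerLeft (K : Ch k) {L M : Ch k} (f : L ⟶ M) (p q i : ℤ) (h : p + q = i) :
    HomologicalComplex.ιTensorObj K L p q i h ≫ (K ◁ f).f i =
      (K.X p ◁ f.f q) ≫ HomologicalComplex.ιTensorObj K M p q i h :=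
  (GradedObject.Monoidal.ι_tensorHom (𝟙 K.X) f.f p q i h).trans (by
    rw [GradedObject.categoryOfGradedObjects_id, MonoidalCategory.id_tensorHom]; rfl)

lemma ι_whiskerRight {K L : Ch k} (f : K ⟶ L) (M : Ch k) (p q i : ℤ) (h : p + q = i) :
    HomologicalComplex.ιTensorObj K M p q i h ≫ (f ▷ M).f i =
      (f.f p ▷ M.X q) ≫ HomologicalComplex.ιTensorObj L M p q i h :=
  (GradedObject.Monoidal.ι_tensorHom f.f (𝟙 M.X) p q i h).trans (by
    rw [GradedObject.categoryOfGradedObjects_id, MonoidalCategory.tensorHom_id]; rfl)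

lemma tensor_hom_ext {K L M : Ch k} {f g : K ⊗ L ⟶ M}
    (H : ∀ (p q i : ℤ) (h : p + q = i), HomologicalComplex.ιTensorObj K L p q i h ≫ f.f i =
      HomologicalComplex.ιTensorObj K L p q i h ≫ g.f i) : f = g := by
  ext i : 1
  exact GradedObject.Monoidal.tensorObj_ext _ _ (fun p q h => H p q i h)

instance chMonoidalPreadditive : MonoidalPreadditive (Ch k) where
  whiskerLeft_zero {K L M} := by
    apply tensor_hom_ext
    intro p q i h
    rw [ι_whiskerLeft, HomologicalComplex.zero_f, HomologicalComplex.zero_f,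
      MonoidalPreadditive.whiskerLeft_zero, zero_comp, comp_zero]
  zero_whiskerRight {K L M} := by
    apply tensor_hom_ext
    intro p q i h
    rw [ι_whiskerRight, HomologicalComplex.zero_f, HomologicalComplex.zero_f,
      MonoidalPreadditive.zero_whiskerRight, zero_comp, comp_zero]
  whiskerLeft_add {K L M} f g := by
    apply tensor_hom_ext
    intro p q i h
    rw [HomologicalComplex.add_f_apply, Preadditive.comp_add, ι_whiskerLeft, ι_whiskerLeft,
      ι_whiskerLeft, HomologicalComplex.add_f_apply, MonoidalPreadditive.whiskerLeft_add,
      Preadditive.add_comp]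
  add_whiskerRight {K L M} f g := by
    apply tensor_hom_ext
    intro p q i h
    rw [HomologicalComplex.add_f_apply, Preadditive.comp_add, ι_whiskerRight, ι_whiskerRight,
      ι_whiskerRight, HomologicalComplex.add_f_apply, MonoidalPreadditive.add_whiskerRight,
      Preadditive.add_comp]

end Cx

section FiniteSets

/-- `I ⊔ (J ⊔ {*}) ≃ (I ⊔ J) ⊔ {*}`. -/
def sumOption (I J : Type) : I ⊕ Option J ≃ Option (I ⊕ J) where
  toFun
    | .inl i => some (.inl i)
    | .inr (some j) => some (.inr j)
    | .inr none => none
  invFun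
    | some (.inl i) => .inl i
    | some (.inr j) => .inr (some j)
    | none => .inr none
  left_inv := by rintro (i | _ | j) <;> rfl
  right_inv := by rintro (_ | i | j) <;> rfl

/-- `(I ⊔ {*}) ⊔ J ≃ (I ⊔ J) ⊔ {*}`. -/
def optionSum (I J : Type) : Option I ⊕ J ≃ Option (I ⊕ J) where
  toFun
    | .inl (some i) => some (.inl i)
    | .inl none => none
    | .inr j => some (.inr j)
  invFun
    | some (.inl i) => .inl (some i)
    | some (.inr j) => .inr j
    | none => .inl none
  left_inv := by rintro ((_ | i) | j) <;> rfl
  right_inv := by rintro (_ | i | j) <;> rfl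

/-- The bijection of `I ⊔ {*} ⊔ {*'}` that exchanges the two added points. -/
def optionSwap (I : Type) : Option (Option I) ≃ Option (Option I) where
  toFun
    | some (some i) => some (some i)
    | some none => none
    | none => some none
  invFun
    | some (some i) => some (some i)
    | some none => none
    | none => some none
  left_inv := by rintro (_ | _ | i) <;> rfl
  right_inv := by rintro (_ | _ | i) <;> rfl

/-- `(I ⊔ J) ⊔ K ≃ (I ⊔ K) ⊔ J`. -/
def sumRightSwap (I J K : Type) : (I ⊕ J) ⊕ K ≃ (I ⊕ K) ⊕ J where
  toFun
    | .inl (.inl i) => .inl (.inl i)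
    | .inl (.inr j) => .inr j
    | .inr k => .inl (.inr k)
  invFun
    | .inl (.inl i) => .inl (.inl i)
    | .inl (.inr k) => .inr k
    | .inr j => .inl (.inr j)
  left_inv := by rintro ((i | j) | k) <;> rfl
  right_inv := by rintro ((i | k) | j) <;> rfl

/-- The one-point set is `∅ ⊔ {*}`. -/
def unitOption : Unit ≃ Option Empty where
  toFun _ := none
  invFun _ := ()
  left_inv _ := rfl
  right_inv := by rintro (_ | i) <;> [rfl; exact i.elim]

/-- The order-preserving bijection between `{0, …, a-1}`, followed by `{0, …, n-1}`,
followed by `{0, …, b-1}`, and `{0, …, a+n+b-1}`. -/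
def finBlocks (a n b : ℕ) : (Fin a ⊕ Fin b) ⊕ Fin n ≃ Fin (a + n + b) :=
  (sumRightSwap (Fin a) (Fin b) (Fin n)).trans
    ((Equiv.sumCongr finSumFinEquiv (Equiv.refl (Fin b))).trans finSumFinEquiv)

/-- The bijection that sends `Fin a` to the first `a` elements, the added point to the element `a`,
and `Fin b` to the last `b` elements, in the given orders. -/
def finSlot (a b : ℕ) : Option (Fin a ⊕ Fin b) ≃ Fin (a + 1 + b) :=
  (Equiv.optionEquivSumPUnit.{0} (Fin a ⊕ Fin b)).trans
    ((Equiv.sumCongr (Equiv.refl _) (Equiv.ofUnique Unit (Fin 1))).trans (finBlocks a 1 b))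

end FiniteSets

/-- A symmetric operad in a symmetric monoidal category, in its coordinate-free form
with partial compositions: a functor on the groupoid of finite sets, a unit, and
a composition `P(I ⊔ {*}) ⊗ P(J) ⟶ P(I ⊔ J)` that inserts the operations with inputs labelled
by `J` at the input `*`, equivariant, unital, and associative (sequentially and in parallel). -/
structure Operad (C : Type u) [Category.{v} C] [MonoidalCategory C] [SymmetricCategory C] where
  /-- The operations with inputs labelled by `I`. -/
  obj (I : Type) [Finite I] : C
  /-- Relabelling of the inputs; for `I = J`, the action of the symmetric group. -/
  map {I J : Type} [Finite I] [Finite J] (e : I ≃ J) : obj I ⟶ obj J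
  map_refl (I : Type) [Finite I] : map (Equiv.refl I) = 𝟙 (obj I)
  map_trans {I J K : Type} [Finite I] [Finite J] [Finite K] (e : I ≃ J) (f : J ≃ K) :
    map (e.trans f) = map e ≫ map f
  /-- The identity operation. -/
  unit : 𝟙_ C ⟶ obj Unit
  /-- The insertion of the second operation at the added input of the first one. -/
  comp (I J : Type) [Finite I] [Finite J] : obj (Option I) ⊗ obj J ⟶ obj (I ⊕ J)
  comp_natural {I I' J J' : Type} [Finite I] [Finite I'] [Finite J] [Finite J']
    (e : I ≃ I') (f : J ≃ J') :
    (map (Equiv.optionCongr e) ⊗ₘ map f) ≫ comp I' J' = comp I J ≫ map (Equiv.sumCongr e f)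
  unit_comp (J : Type) [Finite J] :
    (unit ▷ obj J) ≫ (map unitOption ▷ obj J) ≫ comp Empty J ≫ map (Equiv.emptySum Empty J) =
      (λ_ (obj J)).hom
  comp_unit (I : Type) [Finite I] :
    (obj (Option I) ◁ unit) ≫ comp I Unit ≫ map (Equiv.optionEquivSumPUnit I).symm =
      (ρ_ (obj (Option I))).hom
  assoc_sequential (I J K : Type) [Finite I] [Finite J] [Finite K] :
    (comp I (Option J) ▷ obj K) ≫ (map (sumOption I J) ▷ obj K) ≫ comp (I ⊕ J) K ≫
        map (Equiv.sumAssoc I J K) =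
      (α_ (obj (Option I)) (obj (Option J)) (obj K)).hom ≫ (obj (Option I) ◁ comp J K) ≫
        comp I (J ⊕ K)
  assoc_parallel (I J K : Type) [Finite I] [Finite J] [Finite K] :
    (comp (Option I) J ▷ obj K) ≫ (map (optionSum I J) ▷ obj K) ≫ comp (I ⊕ J) K ≫
        map (sumRightSwap I J K) =
      (α_ (obj (Option (Option I))) (obj J) (obj K)).hom ≫
        (obj (Option (Option I)) ◁ (β_ (obj J) (obj K)).hom) ≫
        (α_ (obj (Option (Option I))) (obj K) (obj J)).inv ≫
        ((map (optionSwap I) ▷ obj K) ▷ obj J) ≫ (comp (Option I) K ▷ obj J) ≫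
        (map (optionSum I K) ▷ obj J) ≫ comp (I ⊕ K) J

section Operads

variable {C : Type u} [Category.{v} C] [MonoidalCategory C]

/-- The tensor power `X^{⊗ n}`. -/
def tpow (X : C) : ℕ → C
  | 0 => 𝟙_ C
  | n + 1 => tpow X n ⊗ X

/-- The action of a morphism on tensor powers. -/
def tpowMap {X Y : C} (f : X ⟶ Y) : ∀ n : ℕ, tpow X n ⟶ tpow Y n
  | 0 => 𝟙 (𝟙_ C)
  | n + 1 => tpowMap f n ⊗ₘ f

/-- The concatenation isomorphism `X^{⊗ a} ⊗ X^{⊗ b} ≅ X^{⊗ (a + b)}`. -/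
def tpowAdd (X : C) (a : ℕ) : ∀ b : ℕ, tpow X a ⊗ tpow X b ≅ tpow X (a + b)
  | 0 => ρ_ (tpow X a)
  | b + 1 => (α_ (tpow X a) (tpow X b) X).symm ≪≫ whiskerRightIso (tpowAdd X a b) X

/-- Splitting a tensor power around its factor in position `a`. -/
def tpowSlot (X : C) (a b : ℕ) : tpow X (a + 1 + b) ≅ (tpow X a ⊗ X) ⊗ tpow X b :=
  (tpowAdd X (a + 1) b).symm

/-- The iterated concatenation `(X^{⊗ a} ⊗ X^{⊗ n}) ⊗ X^{⊗ b} ≅ X^{⊗ (a + n + b)}`. -/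
def tpowBlocks (X : C) (a n b : ℕ) :
    (tpow X a ⊗ tpow X n) ⊗ tpow X b ≅ tpow X (a + n + b) :=
  whiskerRightIso (tpowAdd X a n) (tpow X b) ≪≫ tpowAdd X (a + n) b

/-- The transposition of the factors in positions `a` and `a + 1` of a tensor power. -/
def tpowSwap [SymmetricCategory C] (X : C) (a b : ℕ) :
    tpow X (a + 2 + b) ⟶ tpow X (a + 2 + b) :=
  (tpowAdd X (a + 2) b).inv ≫
    (((α_ (tpow X a) X X).hom ≫ (tpow X a ◁ (β_ X X).hom) ≫ (α_ (tpow X a) X X).inv) ▷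
      tpow X b) ≫ (tpowAdd X (a + 2) b).hom

/-- The transposition of `a` and `a + 1`. -/
def finSwap (a b : ℕ) : Fin (a + 2 + b) ≃ Fin (a + 2 + b) :=
  Equiv.swap ⟨a, by omega⟩ ⟨a + 1, by omega⟩

/-- Given `φ : A ⊗ X ⟶ Y`, the morphism that moves `A` past the first tensor factor `L` of
`(L ⊗ X) ⊗ R`, and then applies `φ` in the middle. -/
def applyAt [SymmetricCategory C] {A X Y : C} (φ : A ⊗ X ⟶ Y) (L R : C) :
    A ⊗ ((L ⊗ X) ⊗ R) ⟶ (L ⊗ Y) ⊗ R :=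
  (α_ A (L ⊗ X) R).inv ≫
    (((α_ A L X).inv ≫ ((β_ A L).hom ▷ X) ≫ (α_ L A X).hom ≫ (L ◁ φ)) ▷ R)

variable [SymmetricCategory C]

/-- A cogebra over the operad `P`: an object `X` with structure morphisms
`P(n) ⊗ X ⟶ X^{⊗ n}`, that is, `P(n) ⟶ [X, X^{⊗ n}]`, which form a morphism of operads from `P`
to the coendomorphism operad of `X`. Equivariance is stated for the adjacent transpositions,
which generate the symmetric groups, and compatibility with the operadic composition for the
partial compositions. -/
structure Cogebra (P : Operad C) where
  /-- The underlying object. -/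
  X : C
  /-- The structure morphisms. -/
  coact (n : ℕ) : P.obj (Fin n) ⊗ X ⟶ tpow X n
  equivariant (a b : ℕ) :
    (P.map (finSwap a b) ▷ X) ≫ coact (a + 2 + b) = coact (a + 2 + b) ≫ tpowSwap X a b
  coact_unit :
    (P.unit ▷ X) ≫ (P.map (Equiv.ofUnique Unit (Fin 1)) ▷ X) ≫ coact 1 = 𝟙 (𝟙_ C ⊗ X)
  coact_comp (a b n : ℕ) :
    (P.comp (Fin a ⊕ Fin b) (Fin n) ▷ X) ≫ (P.map (finBlocks a n b) ▷ X) ≫ coact (a + n + b) =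
      ((β_ (P.obj (Option (Fin a ⊕ Fin b))) (P.obj (Fin n))).hom ▷ X) ≫
        (α_ (P.obj (Fin n)) (P.obj (Option (Fin a ⊕ Fin b))) X).hom ≫
        (P.obj (Fin n) ◁
          ((P.map (finSlot a b) ▷ X) ≫ coact (a + 1 + b) ≫ (tpowSlot X a b).hom)) ≫
        applyAt (coact n) (tpow X a) (tpow X b) ≫ (tpowBlocks X a n b).hom

namespace Cogebra

variable {P : Operad C}

/-- A morphism of cogebras. -/
@[ext]
structure Hom (V W : Cogebra P) where
  hom : V.X ⟶ W.X
  comm (n : ℕ) : V.coact n ≫ tpowMap hom n = (P.obj (Fin n) ◁ hom) ≫ W.coact n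

lemma tpowMap_id (X : C) (n : ℕ) : tpowMap (𝟙 X) n = 𝟙 (tpow X n) := by
  induction n with
  | zero => rfl
  | succ n ih => simp [tpowMap, tpow, ih]

lemma tpowMap_comp {X Y Z : C} (f : X ⟶ Y) (g : Y ⟶ Z) (n : ℕ) :
    tpowMap (f ≫ g) n = tpowMap f n ≫ tpowMap g n := by
  induction n with
  | zero => exact (Category.comp_id (𝟙 (𝟙_ C))).symm
  | succ n ih =>
    simp only [tpowMap, ih]
    exact (MonoidalCategory.tensorHom_comp_tensorHom _ _ _ _).symm

instance : Category (Cogebra P) where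
  Hom V W := Hom V W
  id V := ⟨𝟙 V.X, fun n => by
    rw [tpowMap_id, Category.comp_id, MonoidalCategory.whiskerLeft_id, Category.id_comp]⟩
  comp f g := ⟨f.hom ≫ g.hom, fun n => by
    rw [tpowMap_comp, ← Category.assoc, f.comm, Category.assoc, g.comm,
      MonoidalCategory.whiskerLeft_comp, Category.assoc]⟩
  id_comp f := Hom.ext (Category.id_comp f.hom)
  comp_id f := Hom.ext (Category.comp_id f.hom)
  assoc f g h := Hom.ext (Category.assoc f.hom g.hom h.hom)

variable (P) in
/-- The forgetful functor from cogebras to the underlying category. -/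
def forget : Cogebra P ⥤ C where
  obj V := V.X
  map f := f.hom

end Cogebra

end Operads

section Com

variable (C : Type u) [Category.{v} C] [MonoidalCategory C] [SymmetricCategory C]

lemma braiding_unit : (β_ (𝟙_ C) (𝟙_ C)).hom = 𝟙 (𝟙_ C ⊗ 𝟙_ C) := by
  rw [braiding_tensorUnit_left, unitors_equal, Iso.hom_inv_id]

/-- The operad of unital commutative algebras: the monoidal unit in every arity,
with trivial symmetric group actions and with the canonical isomorphisms as compositions.
Its cogebras are the counital cocommutative cogebras. -/
def uCom : Operad C where
  obj _ _ := 𝟙_ C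
  map _ := 𝟙 (𝟙_ C)
  map_refl _ _ := rfl
  map_trans _ _ := (Category.comp_id _).symm
  unit := 𝟙 (𝟙_ C)
  comp _ _ _ _ := (λ_ (𝟙_ C)).hom
  comp_natural _ _ := by simp
  unit_comp _ _ := by simp
  comp_unit _ _ := by simp [unitors_equal]
  assoc_sequential _ _ _ _ _ _ := by
    simp only [MonoidalCategory.id_whiskerRight, Category.id_comp, Category.comp_id]
    monoidal
  assoc_parallel _ _ _ _ _ _ := by
    rw [braiding_unit]
    simp only [MonoidalCategory.whiskerLeft_id, MonoidalCategory.id_whiskerRight,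
      Category.id_comp, Category.comp_id, Iso.hom_inv_id_assoc]

section Nonunital

open scoped ZeroObject

variable [Preadditive C] [HasZeroObject C] [MonoidalPreadditive C]

open scoped Classical in
/-- The monoidal unit if `I` is non-empty, and zero if `I` is empty. -/
noncomputable def comObj (I : Type) : C := if Nonempty I then 𝟙_ C else 0

open scoped Classical in
/-- The canonical morphism to the unit: the identity if `I` is non-empty, zero otherwise. -/
noncomputable def comTo (I : Type) : comObj C I ⟶ 𝟙_ C :=
  if h : Nonempty I then eqToHom (if_pos h) else 0

open scoped Classical in
/-- The canonical morphism from the unit: the identity if `I` is non-empty, zero otherwise. -/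
noncomputable def comFrom (I : Type) : 𝟙_ C ⟶ comObj C I :=
  if h : Nonempty I then eqToHom (if_pos h).symm else 0

lemma comTo_comFrom (I : Type) : comTo C I ≫ comFrom C I = 𝟙 (comObj C I) := by
  by_cases h : Nonempty I
  · simp only [comTo, comFrom, dif_pos h]
    exact eqToHom_trans _ _
  · have : IsZero (comObj C I) := by
      rw [comObj, if_neg h]
      exact isZero_zero C
    exact this.eq_of_src _ _

lemma comFrom_comTo (I : Type) [h : Nonempty I] : comFrom C I ≫ comTo C I = 𝟙 (𝟙_ C) := by
  simp only [comTo, comFrom, dif_pos h]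
  exact eqToHom_trans _ _

lemma comTo_of_isEmpty (I : Type) [h : IsEmpty I] : comTo C I = 0 :=
  dif_neg (not_nonempty_iff.mpr h)

lemma comFrom_comTo_assoc (I : Type) [Nonempty I] {X : C} (f : 𝟙_ C ⟶ X) :
    comFrom C I ≫ comTo C I ≫ f = f := by
  rw [← Category.assoc, comFrom_comTo, Category.id_comp]

lemma whiskerRight_comp_tensorHom {X Y Z V W : C} (f : X ⟶ Y) (g : Y ⟶ Z) (h : V ⟶ W) :
    (f ▷ V) ≫ (g ⊗ₘ h) = (f ≫ g) ⊗ₘ h := by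
  rw [← MonoidalCategory.tensorHom_id, MonoidalCategory.tensorHom_comp_tensorHom,
    Category.id_comp]

lemma whiskerLeft_comp_tensorHom {X Y Z V W : C} (f : X ⟶ Y) (g : Y ⟶ Z) (h : V ⟶ W) :
    (V ◁ f) ≫ (h ⊗ₘ g) = h ⊗ₘ (f ≫ g) := by
  rw [← MonoidalCategory.id_tensorHom, MonoidalCategory.tensorHom_comp_tensorHom,
    Category.id_comp]

lemma whiskerRight_comp_tensorHom_assoc {X Y Z V W U : C} (f : X ⟶ Y) (g : Y ⟶ Z) (h : V ⟶ W)
    (r : Z ⊗ W ⟶ U) : (f ▷ V) ≫ (g ⊗ₘ h) ≫ r = ((f ≫ g) ⊗ₘ h) ≫ r := by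
  rw [← Category.assoc, whiskerRight_comp_tensorHom]

lemma whiskerLeft_comp_tensorHom_assoc {X Y Z V W U : C} (f : X ⟶ Y) (g : Y ⟶ Z) (h : V ⟶ W)
    (r : W ⊗ Z ⟶ U) : (V ◁ f) ≫ (h ⊗ₘ g) ≫ r = (h ⊗ₘ (f ≫ g)) ≫ r := by
  rw [← Category.assoc, whiskerLeft_comp_tensorHom]

lemma comp_tensorHom {X Y Z V W : C} (f : X ⟶ Y) (g : Y ⟶ Z) (h : V ⟶ W) :
    (f ≫ g) ⊗ₘ h = (f ⊗ₘ h) ≫ (g ▷ W) := by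
  rw [← MonoidalCategory.tensorHom_id, MonoidalCategory.tensorHom_comp_tensorHom,
    Category.comp_id]

lemma tensorHom_comp {X Y Z V W : C} (f : X ⟶ Y) (g : Y ⟶ Z) (h : V ⟶ W) :
    h ⊗ₘ (f ≫ g) = (h ⊗ₘ f) ≫ (W ◁ g) := by
  rw [← MonoidalCategory.id_tensorHom, MonoidalCategory.tensorHom_comp_tensorHom,
    Category.comp_id]

/-- The operad of non-unital commutative algebras: the monoidal unit in every arity `n ≥ 1`,
and zero in arity `0`, with trivial symmetric group actions and with the canonical isomorphisms
as compositions. Its cogebras are the not necessarily counital cocommutative cogebras. -/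
noncomputable def Com : Operad C where
  obj I _ := comObj C I
  map {I J} _ _ _ := comTo C I ≫ comFrom C J
  map_refl I _ := comTo_comFrom C I
  map_trans {I J K} _ _ _ e f := by
    rw [Category.assoc]
    rcases isEmpty_or_nonempty I with h | h
    · simp [comTo_of_isEmpty C I]
    · have : Nonempty J := h.map e
      rw [comFrom_comTo_assoc]
  unit := comFrom C Unit
  comp I J _ _ := (comTo C (Option I) ⊗ₘ comTo C J) ≫ (λ_ (𝟙_ C)).hom ≫ comFrom C (I ⊕ J)
  comp_natural {I I' J J'} _ _ _ _ e f := by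
    rw [MonoidalCategory.tensorHom_comp_tensorHom_assoc]
    rcases isEmpty_or_nonempty J with h | h
    · simp [comTo_of_isEmpty C J]
    · have : Nonempty J' := h.map f
      simp only [Category.assoc, comFrom_comTo, comFrom_comTo_assoc, Category.comp_id]
  unit_comp J _ := by
    rw [MonoidalCategory.comp_whiskerRight]
    simp only [Category.assoc, whiskerRight_comp_tensorHom_assoc, comFrom_comTo, Category.comp_id]
    rw [MonoidalCategory.id_tensorHom]
    rcases isEmpty_or_nonempty J with h | h
    · have : IsZero (comObj C J) := by
        rw [IsZero.iff_id_eq_zero, ← comTo_comFrom, comTo_of_isEmpty, zero_comp]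
      exact this.eq_of_tgt _ _
    · simp only [comFrom_comTo_assoc, MonoidalCategory.leftUnitor_naturality_assoc,
        comTo_comFrom, Category.comp_id]
  comp_unit I _ := by
    simp only [Category.assoc, comFrom_comTo_assoc, whiskerLeft_comp_tensorHom_assoc,
      comFrom_comTo]
    rw [MonoidalCategory.tensorHom_id, unitors_equal,
      MonoidalCategory.rightUnitor_naturality_assoc, comTo_comFrom, Category.comp_id]
  assoc_sequential I J K _ _ _ := by
    rcases isEmpty_or_nonempty K with h | h
    · simp [comTo_of_isEmpty C K]
    · simp only [Category.assoc, whiskerRight_comp_tensorHom_assoc,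
        whiskerLeft_comp_tensorHom_assoc, comFrom_comTo, comFrom_comTo_assoc, Category.comp_id]
      simp only [comp_tensorHom, tensorHom_comp, Category.assoc,
        ← MonoidalCategory.associator_naturality_assoc]
      congr 1
      simp only [← Category.assoc]
      congr 1
      monoidal
  assoc_parallel I J K _ _ _ := by
    rcases isEmpty_or_nonempty K with h | h
    · simp [comTo_of_isEmpty C K]
    · rcases isEmpty_or_nonempty J with h | h
      · simp [comTo_of_isEmpty C J]
      · simp only [Category.assoc, whiskerRight_comp_tensorHom_assoc, comFrom_comTo,
          comFrom_comTo_assoc, Category.comp_id]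
        simp only [comp_tensorHom, Category.assoc,
          ← MonoidalCategory.associator_inv_naturality_assoc]
        rw [whiskerLeft_comp_tensorHom_assoc, ← BraidedCategory.braiding_naturality,
          braiding_unit, Category.comp_id, ← MonoidalCategory.associator_naturality_assoc]
        simp

end Nonunital

end Com
section Coadmissible

open HomotopicalAlgebra

variable {k : Type u} [Field k] (P : Operad (Ch k))

/-- The morphisms of cogebras whose underlying morphism of chain complexes is
a quasi-isomorphism. -/
def weakEquiv : MorphismProperty (Cogebra P) :=
  (HomologicalComplex.quasiIso (ModuleCat.{u} k) (ComplexShape.down ℤ)).inverseImage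
    (Cogebra.forget P)

/-- The morphisms of cogebras whose underlying morphism of chain complexes is
a degree-wise monomorphism. -/
def cofib : MorphismProperty (Cogebra P) :=
  fun _ _ f => ∀ i : ℤ, Mono (((Cogebra.forget P).map f).f i)

/-- The morphisms of cogebras with the right lifting property against the morphisms that are both
weak equivalences and cofibrations. -/
def fib : MorphismProperty (Cogebra P) := (weakEquiv P ⊓ cofib P).rlp

/-- An operad `P` in chain complexes is coadmissible if the category of `P`-cogebras is
a model category for the above weak equivalences, cofibrations and fibrations. -/
def Coadmissible : Prop :=
  ∃ M : ModelCategory (Cogebra P),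
    @weakEquivalences _ _ M.categoryWithWeakEquivalences = weakEquiv P ∧
    @cofibrations _ _ M.categoryWithCofibrations = cofib P ∧
    @fibrations _ _ M.categoryWithFibrations = fib P

end Coadmissible

end DG

/-! The obstruction is a missing cylinder. Let `U` be the unit complex and let `U ⊞ U` be the
cogebra spanned by two grouplike elements. A model structure would factor the fold map `U ⊞ U ⟶ U`
as a degreewise injection into some cogebra `Z` followed by a quasi-isomorphism `p`, and
`no_cylinder` shows that no such factorization exists.

Let `e₀`, `e₁` be the images in `Z` of the two points. They have the same image under `p`, so `e₁ -
e₀ = d w`. Choose a linear form `f` on `Z₀` with `f e₀ = 0` and `f e₁ = 1`, and let `T` be the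
contraction of the comultiplication with `f`. Then `T e₀ = 0` and `T e₁ = e₁`. The commutator `D` of
`T` and `d` is the contraction with `f ∘ d`, and it commutes with `T` because the comultiplication
is coassociative and cocommutative. Hence `q(T) d = d q(T) + q'(T) D` for every polynomial `q`
(`aeval_derivative`).

The vectors `T^(n+1) D w` are contractions of the single tensor `δ (D w)`, so they span a
finite-dimensional space (`contr_finite`), and `T r(T) D w = 0` for some `r ≠ 0`. Take `q` with
`q(0) = 0`, `q(1) = 1` and `X r ∣ q'` (`exists_separating_polynomial`). Applying `q(T)` to `d w = e₁
- e₀` gives `e₁ = d (q(T) w)`. So `e₁` is a boundary, although `p e₁` is the generator of `U`, whose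
differential is zero.

Both operads are treated at once through `CommData`: the operations `μ` give every cogebra its
comultiplication, and the augmentation `ε` makes points grouplike. -/

namespace DG

/-! ### Comultiplications induced by commutative operations -/

section Commutative

variable {C : Type u} [Category.{v} C] [MonoidalCategory C] [SymmetricCategory C]

/-- An operad whose operations of arity `n ≥ 1` contain a distinguished element `μ`,
which is symmetric and stable under composition, together with an augmentation to the operad of
unital commutative algebras that sends `μ` to the canonical operation. -/
structure CommData (P : Operad C) where
  /-- The augmentation. -/
  ε (I : Type) [Finite I] : P.obj I ⟶ 𝟙_ C
  /-- The distinguished operations. -/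
  μ (I : Type) [Finite I] [Nonempty I] : 𝟙_ C ⟶ P.obj I
  μ_ε (I : Type) [Finite I] [Nonempty I] : μ I ≫ ε I = 𝟙 (𝟙_ C)
  map_ε {I J : Type} [Finite I] [Finite J] (e : I ≃ J) : P.map e ≫ ε J = ε I
  unit_ε : P.unit ≫ ε Unit = 𝟙 (𝟙_ C)
  comp_ε (I J : Type) [Finite I] [Finite J] :
    P.comp I J ≫ ε (I ⊕ J) = (ε (Option I) ⊗ₘ ε J) ≫ (λ_ (𝟙_ C)).hom
  μ_map {I J : Type} [Finite I] [Finite J] [Nonempty I] [Nonempty J] (e : I ≃ J) :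
    μ I ≫ P.map e = μ J
  μ_comp (I J : Type) [Finite I] [Finite J] [Nonempty J] :
    (μ (Option I) ⊗ₘ μ J) ≫ P.comp I J = (λ_ (𝟙_ C)).hom ≫ μ (I ⊕ J)

/-- The operad of unital commutative algebras is augmented over itself. -/
def uComData : CommData (uCom C) where
  ε _ _ := 𝟙 (𝟙_ C)
  μ _ _ _ := 𝟙 (𝟙_ C)
  μ_ε _ _ _ := Category.comp_id _
  map_ε _ := Category.comp_id _
  unit_ε := Category.comp_id _
  comp_ε _ _ _ _ := by simp [uCom]
  μ_map _ := Category.comp_id _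
  μ_comp _ _ _ _ _ := by simp [uCom]

/-- The inclusion of the operad of non-unital commutative algebras into that of
unital commutative algebras. -/
noncomputable def comData [Preadditive C] [HasZeroObject C] [MonoidalPreadditive C] :
    CommData (Com C) where
  ε I _ := comTo C I
  μ I _ _ := comFrom C I
  μ_ε I _ _ := comFrom_comTo C I
  map_ε {I J} _ _ e := by
    show (comTo C I ≫ comFrom C J) ≫ comTo C J = comTo C I
    rcases isEmpty_or_nonempty J with h | h
    · have : IsEmpty I := ⟨fun i => h.false (e i)⟩
      simp [comTo_of_isEmpty]
    · rw [Category.assoc, comFrom_comTo, Category.comp_id]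
  unit_ε := comFrom_comTo C Unit
  comp_ε I J _ _ := by
    show ((comTo C (Option I) ⊗ₘ comTo C J) ≫ (λ_ (𝟙_ C)).hom ≫ comFrom C (I ⊕ J)) ≫ _ = _
    rcases isEmpty_or_nonempty J with h | h
    · simp only [comTo_of_isEmpty C J, MonoidalPreadditive.tensor_zero, zero_comp]
      exact ((congrArg (· ≫ (λ_ (𝟙_ C)).hom) (MonoidalPreadditive.tensor_zero _)).trans
        zero_comp).symm
    · simp only [Category.assoc, comFrom_comTo, Category.comp_id]
      rfl
  μ_map {I J} _ _ _ _ e := by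
    show comFrom C I ≫ comTo C I ≫ comFrom C J = comFrom C J
    rw [comFrom_comTo_assoc]
  μ_comp I J _ _ _ := by
    have h : (comFrom C (Option I) ⊗ₘ comFrom C J) ≫ (comTo C (Option I) ⊗ₘ comTo C J) ≫
        (λ_ (𝟙_ C)).hom ≫ comFrom C (I ⊕ J) = (λ_ (𝟙_ C)).hom ≫ comFrom C (I ⊕ J) := by
      rw [MonoidalCategory.tensorHom_comp_tensorHom_assoc, comFrom_comTo, comFrom_comTo,
        MonoidalCategory.id_tensorHom_id, Category.id_comp]
    exact h

section ApplyAt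

lemma whiskerRight_applyAt {A B X Y : C} (a : A ⟶ B) (φ : B ⊗ X ⟶ Y) (L R : C) :
    (a ▷ ((L ⊗ X) ⊗ R)) ≫ applyAt φ L R = applyAt ((a ▷ X) ≫ φ) L R := by
  have h : (a ▷ (L ⊗ X)) ≫ (α_ B L X).inv ≫ ((β_ B L).hom ▷ X) ≫ (α_ L B X).hom ≫ (L ◁ φ) =
      (α_ A L X).inv ≫ ((β_ A L).hom ▷ X) ≫ (α_ L A X).hom ≫ (L ◁ ((a ▷ X) ≫ φ)) := by
    rw [MonoidalCategory.associator_inv_naturality_left_assoc,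
      ← MonoidalCategory.comp_whiskerRight_assoc, BraidedCategory.braiding_naturality_left,
      MonoidalCategory.comp_whiskerRight_assoc,
      MonoidalCategory.associator_naturality_middle_assoc, MonoidalCategory.whiskerLeft_comp]
  rw [applyAt, applyAt, MonoidalCategory.associator_inv_naturality_left_assoc,
    ← MonoidalCategory.comp_whiskerRight, h]

lemma applyAt_unit {X Y : C} (φ : X ⟶ Y) (L R : C) :
    applyAt ((λ_ X).hom ≫ φ) L R = (λ_ _).hom ≫ ((L ◁ φ) ▷ R) := by
  simp [applyAt, braiding_tensorUnit_left]

/-- Used with `x` a point and `y` its tensor power: it moves the evaluation of a partial composition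
at a grouplike element into the unit object. -/
lemma applyAt_naturality {A X X' Y Y' L L' R R' : C} {φ : A ⊗ X ⟶ Y} {φ' : A ⊗ X' ⟶ Y'}
    {x : X ⟶ X'} {y : Y ⟶ Y'} (h : φ ≫ y = (A ◁ x) ≫ φ') (l : L ⟶ L') (r : R ⟶ R') :
    (A ◁ ((l ⊗ₘ x) ⊗ₘ r)) ≫ applyAt φ' L' R' = applyAt φ L R ≫ ((l ⊗ₘ y) ⊗ₘ r) := by
  have h' : (A ◁ (l ⊗ₘ x)) ≫ (α_ A L' X').inv ≫ ((β_ A L').hom ▷ X') ≫ (α_ L' A X').hom ≫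
      (L' ◁ φ') = ((α_ A L X).inv ≫ ((β_ A L).hom ▷ X) ≫ (α_ L A X).hom ≫ (L ◁ φ)) ≫
        (l ⊗ₘ y) := by
    rw [← MonoidalCategory.id_tensorHom, MonoidalCategory.associator_inv_naturality_assoc,
      ← MonoidalCategory.tensorHom_id, MonoidalCategory.tensorHom_comp_tensorHom_assoc,
      BraidedCategory.braiding_naturality, Category.comp_id]
    have e : ((β_ A L).hom ≫ (l ⊗ₘ 𝟙 A) ⊗ₘ x) = ((β_ A L).hom ▷ X) ≫ ((l ⊗ₘ 𝟙 A) ⊗ₘ x) := by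
      rw [← MonoidalCategory.tensorHom_id, MonoidalCategory.tensorHom_comp_tensorHom,
        Category.id_comp]
    rw [e, Category.assoc, MonoidalCategory.associator_naturality_assoc]
    have e' : (l ⊗ₘ (𝟙 A ⊗ₘ x)) ≫ (L' ◁ φ') = (L ◁ φ) ≫ (l ⊗ₘ y) := by
      rw [← MonoidalCategory.id_tensorHom L', MonoidalCategory.tensorHom_comp_tensorHom,
        MonoidalCategory.id_tensorHom, ← h, ← MonoidalCategory.id_tensorHom L,
        MonoidalCategory.tensorHom_comp_tensorHom, Category.id_comp, Category.comp_id]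
    rw [e']
    simp only [Category.assoc]
  rw [applyAt, applyAt, ← MonoidalCategory.id_tensorHom,
    MonoidalCategory.associator_inv_naturality_assoc, MonoidalCategory.id_tensorHom,
    ← MonoidalCategory.tensorHom_id, MonoidalCategory.tensorHom_comp_tensorHom, h',
    Category.assoc (α_ A (L ⊗ X) R).inv, ← MonoidalCategory.tensorHom_id _ R,
    MonoidalCategory.tensorHom_comp_tensorHom, Category.comp_id, Category.id_comp]

end ApplyAt

section Comultiplication

variable {P : Operad C} (D : CommData P) (V : Cogebra P)

namespace CommData

/-- The `n`-fold comultiplication of a cogebra. -/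
def comul (n : ℕ) [Nonempty (Fin n)] : V.X ⟶ tpow V.X n :=
  (λ_ V.X).inv ≫ (D.μ (Fin n) ▷ V.X) ≫ V.coact n

lemma μ_coact (n : ℕ) [Nonempty (Fin n)] :
    (D.μ (Fin n) ▷ V.X) ≫ V.coact n = (λ_ V.X).hom ≫ D.comul V n := by
  simp [comul]

/-- This is the composition axiom of the cogebra evaluated at `μ ⊗ μ`. Composites of the `μ` are
again `μ`, and the braiding of the two operadic factors becomes the braiding of the unit with
itself, which is the identity. -/
lemma comul_comp (a b n : ℕ) [Nonempty (Fin n)] [Nonempty (Fin (a + 1 + b))]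
    [Nonempty (Fin (a + n + b))] :
    D.comul V (a + n + b) = D.comul V (a + 1 + b) ≫ (tpowSlot V.X a b).hom ≫
      ((tpow V.X a ◁ D.comul V n) ▷ tpow V.X b) ≫ (tpowBlocks V.X a n b).hom := by
  have H := congrArg (fun t => (λ_ V.X).inv ≫ ((λ_ (𝟙_ C)).inv ▷ V.X) ≫
    ((D.μ (Option (Fin a ⊕ Fin b)) ⊗ₘ D.μ (Fin n)) ▷ V.X) ≫ t) (V.coact_comp a b n)
  have : Nonempty ((Fin a ⊕ Fin b) ⊕ Fin n) := ⟨.inr (Classical.arbitrary _)⟩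
  have e₁ : ((D.μ (Option (Fin a ⊕ Fin b)) ⊗ₘ D.μ (Fin n)) ▷ V.X) ≫
      (P.comp (Fin a ⊕ Fin b) (Fin n) ▷ V.X) ≫ (P.map (finBlocks a n b) ▷ V.X) ≫
        V.coact (a + n + b) = ((λ_ (𝟙_ C)).hom ▷ V.X) ≫ (λ_ V.X).hom ≫ D.comul V _ := by
    rw [← MonoidalCategory.comp_whiskerRight_assoc, μ_comp,
      MonoidalCategory.comp_whiskerRight_assoc,
      ← MonoidalCategory.comp_whiskerRight_assoc (D.μ ((Fin a ⊕ Fin b) ⊕ Fin n)),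
      μ_map, μ_coact]
  have e₂ : (D.μ (Option (Fin a ⊕ Fin b)) ▷ V.X) ≫ (P.map (finSlot a b) ▷ V.X) ≫
      V.coact (a + 1 + b) = (λ_ V.X).hom ≫ D.comul V _ := by
    rw [← MonoidalCategory.comp_whiskerRight_assoc, μ_map, μ_coact]
  have e₃ {W : C} (t : P.obj (Fin n) ⊗ P.obj (Option (Fin a ⊕ Fin b)) ⊗ V.X ⟶ W) :
      ((D.μ (Option (Fin a ⊕ Fin b)) ⊗ₘ D.μ (Fin n)) ▷ V.X) ≫
      ((β_ (P.obj (Option (Fin a ⊕ Fin b))) (P.obj (Fin n))).hom ▷ V.X) ≫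
        (α_ (P.obj (Fin n)) (P.obj (Option (Fin a ⊕ Fin b))) V.X).hom ≫ t =
      (α_ _ _ _).hom ≫ (𝟙_ C ◁ (D.μ (Option (Fin a ⊕ Fin b)) ▷ V.X)) ≫
        (D.μ (Fin n) ▷ _) ≫ t := by
    rw [← MonoidalCategory.comp_whiskerRight_assoc, BraidedCategory.braiding_naturality,
      braiding_unit, Category.id_comp, MonoidalCategory.tensorHom_def',
      MonoidalCategory.comp_whiskerRight_assoc, MonoidalCategory.associator_naturality_left_assoc,
      MonoidalCategory.associator_naturality_middle_assoc]
  replace H := H.trans (congrArg (fun t => (λ_ V.X).inv ≫ ((λ_ (𝟙_ C)).inv ▷ V.X) ≫ t)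
    (e₃ _))
  replace e₁ := congrArg (fun t => (λ_ V.X).inv ≫ ((λ_ (𝟙_ C)).inv ▷ V.X) ≫ t) e₁
  replace H := e₁.symm.trans H
  rw [← MonoidalCategory.whisker_exchange_assoc, reassoc_of% (whiskerRight_applyAt (D.μ (Fin n))),
    μ_coact, applyAt_unit, ← MonoidalCategory.whiskerLeft_comp_assoc, reassoc_of% e₂] at H
  simpa using H

lemma comul_swap (a b : ℕ) [Nonempty (Fin (a + 2 + b))] :
    D.comul V (a + 2 + b) ≫ tpowSwap V.X a b = D.comul V (a + 2 + b) := by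
  rw [comul, Category.assoc, Category.assoc, ← V.equivariant,
    ← MonoidalCategory.comp_whiskerRight_assoc, μ_map]

/-- The comultiplication of a cogebra. -/
def δ : V.X ⟶ V.X ⊗ V.X := D.comul V 2 ≫ ((λ_ V.X).hom ▷ V.X)

lemma comul_two : D.comul V 2 = D.δ V ≫ ((λ_ V.X).inv ▷ V.X) := by
  have e : ((λ_ V.X).hom ▷ V.X) ≫ ((λ_ V.X).inv ▷ V.X) = 𝟙 _ := by simp
  exact ((Category.assoc _ _ _).trans
    ((congrArg (D.comul V 2 ≫ ·) e).trans (Category.comp_id _))).symm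

lemma δ_comm : D.δ V ≫ (β_ V.X V.X).hom = D.δ V := by
  have h := D.comul_swap V 0 0
  have e : tpowSwap V.X 0 0 ≫ ((λ_ V.X).hom ▷ V.X) =
      ((λ_ V.X).hom ▷ V.X) ≫ (β_ V.X V.X).hom := by
    simp [tpowSwap, tpowAdd, tpow]
  exact (Category.assoc _ _ _).trans ((congrArg (D.comul V 2 ≫ ·) e.symm).trans
    ((Category.assoc _ _ _).symm.trans (congrArg (· ≫ ((λ_ V.X).hom ▷ V.X)) h)))

/-- Inserting the binary operation into the first or the second input of itself gives the same
ternary operation, so both sides are the threefold comultiplication. -/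
lemma δ_assoc : D.δ V ≫ (D.δ V ▷ V.X) ≫ (α_ V.X V.X V.X).hom = D.δ V ≫ (V.X ◁ D.δ V) := by
  -- Both arities, `0 + 2 + 1` and `1 + 2 + 0`, compute to `3`. The remaining work removes the unit
  -- factor with which `tpow` begins.
  have h := (D.comul_comp V 0 1 2).symm.trans (D.comul_comp V 1 0 2)
  replace h := congrArg (· ≫ (((λ_ V.X).hom ▷ V.X) ▷ V.X) ≫ (α_ V.X V.X V.X).hom) h
  have e₁ : ((tpowSlot V.X 0 1).hom ≫ ((tpow V.X 0 ◁ D.comul V 2) ▷ tpow V.X 1) ≫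
      (tpowBlocks V.X 0 2 1).hom) ≫ (((λ_ V.X).hom ▷ V.X) ▷ V.X) ≫ (α_ V.X V.X V.X).hom =
      ((λ_ V.X).hom ▷ V.X) ≫ (D.δ V ▷ V.X) ≫ (α_ V.X V.X V.X).hom := by
    rw [comul_two]
    simp [tpowSlot, tpowBlocks, tpowAdd, tpow]
    monoidal
  have e₂ : ((tpowSlot V.X 1 0).hom ≫ ((tpow V.X 1 ◁ D.comul V 2) ▷ tpow V.X 0) ≫
      (tpowBlocks V.X 1 2 0).hom) ≫ (((λ_ V.X).hom ▷ V.X) ▷ V.X) ≫ (α_ V.X V.X V.X).hom =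
      ((λ_ V.X).hom ▷ V.X) ≫ (V.X ◁ D.δ V) := by
    rw [comul_two]
    simp [tpowSlot, tpowBlocks, tpowAdd, tpow]
    monoidal
  exact (Category.assoc _ _ _).trans (((congrArg (D.comul V 2 ≫ ·) e₁.symm).trans
    ((Category.assoc _ _ _).symm.trans (h.trans ((Category.assoc _ _ _).trans
      (congrArg (D.comul V 2 ≫ ·) e₂))))).trans (Category.assoc _ _ _).symm)

variable {V} in
lemma hom_comul {W : Cogebra P} (f : V ⟶ W) (n : ℕ) [Nonempty (Fin n)] :
    f.hom ≫ D.comul W n = D.comul V n ≫ tpowMap f.hom n := by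
  simp only [comul, Category.assoc]
  rw [f.comm, MonoidalCategory.leftUnitor_inv_naturality_assoc,
    MonoidalCategory.whisker_exchange_assoc]

variable {V} in
lemma hom_δ {W : Cogebra P} (f : V ⟶ W) :
    f.hom ≫ D.δ W = D.δ V ≫ (f.hom ⊗ₘ f.hom) := by
  have e : tpowMap f.hom 2 ≫ ((λ_ W.X).hom ▷ W.X) =
      ((λ_ V.X).hom ▷ V.X) ≫ (f.hom ⊗ₘ f.hom) := by
    simp [tpowMap, tpow, MonoidalCategory.tensorHom_def]
  exact (Category.assoc _ _ _).symm.trans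
    ((congrArg (· ≫ ((λ_ W.X).hom ▷ W.X)) (D.hom_comul f 2)).trans ((Category.assoc _ _ _).trans
    ((congrArg (D.comul V 2 ≫ ·) e).trans (Category.assoc _ _ _).symm)))

end CommData

end Comultiplication

end Commutative

end DG

namespace DG

/-! ### Cogebras spanned by finitely many grouplike elements -/

section Grouplike

variable {C : Type u} [Category.{v} C] [MonoidalCategory C]

/-- The tensor powers of a point. -/
def ptPow {S : C} (j : 𝟙_ C ⟶ S) : ∀ n : ℕ, 𝟙_ C ⟶ tpow S n
  | 0 => 𝟙 (𝟙_ C)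
  | n + 1 => (λ_ (𝟙_ C)).inv ≫ (ptPow j n ⊗ₘ j)

lemma ptPow_map {S T : C} (j : 𝟙_ C ⟶ S) (h : S ⟶ T) (n : ℕ) :
    ptPow j n ≫ tpowMap h n = ptPow (j ≫ h) n := by
  induction n with
  | zero => exact Category.comp_id (𝟙 (𝟙_ C))
  | succ n ih =>
    have e : (ptPow j n ⊗ₘ j) ≫ (tpowMap h n ⊗ₘ h) = ptPow (j ≫ h) n ⊗ₘ (j ≫ h) := by
      rw [MonoidalCategory.tensorHom_comp_tensorHom, ih]
    exact (Category.assoc _ _ _).trans (congrArg ((λ_ (𝟙_ C)).inv ≫ ·) e)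

lemma ptPow_add {S : C} (j : 𝟙_ C ⟶ S) (a b : ℕ) :
    (ptPow j a ⊗ₘ ptPow j b) ≫ (tpowAdd S a b).hom = (λ_ (𝟙_ C)).hom ≫ ptPow j (a + b) := by
  induction b with
  | zero =>
    have e : (ptPow j a ⊗ₘ 𝟙 (𝟙_ C)) ≫ (ρ_ (tpow S a)).hom = (λ_ (𝟙_ C)).hom ≫ ptPow j a := by
      rw [unitors_equal, MonoidalCategory.tensorHom_id, MonoidalCategory.rightUnitor_naturality]
    exact e
  | succ b ih =>
    have e : (ptPow j a ⊗ₘ ((λ_ (𝟙_ C)).inv ≫ (ptPow j b ⊗ₘ j))) ≫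
        (α_ (tpow S a) (tpow S b) S).inv ≫ ((tpowAdd S a b).hom ▷ S) =
        (λ_ (𝟙_ C)).hom ≫ (λ_ (𝟙_ C)).inv ≫ (ptPow j (a + b) ⊗ₘ j) := by
      have e₁ : ptPow j a ⊗ₘ ((λ_ (𝟙_ C)).inv ≫ (ptPow j b ⊗ₘ j)) =
          (𝟙_ C ◁ (λ_ (𝟙_ C)).inv) ≫ (ptPow j a ⊗ₘ (ptPow j b ⊗ₘ j)) := by
        rw [← MonoidalCategory.id_tensorHom, MonoidalCategory.tensorHom_comp_tensorHom,
          Category.id_comp]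
      have e₂ : ((ptPow j a ⊗ₘ ptPow j b) ⊗ₘ j) ≫ ((tpowAdd S a b).hom ▷ S) =
          ((λ_ (𝟙_ C)).hom ▷ 𝟙_ C) ≫ (ptPow j (a + b) ⊗ₘ j) := by
        rw [← MonoidalCategory.tensorHom_id, MonoidalCategory.tensorHom_comp_tensorHom, ih,
          ← MonoidalCategory.tensorHom_id, MonoidalCategory.tensorHom_comp_tensorHom,
          Category.id_comp, Category.comp_id]
      rw [e₁, Category.assoc, MonoidalCategory.associator_inv_naturality_assoc, e₂]
      simp only [← Category.assoc]
      congr 1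
      monoidal
    exact e

lemma ptPow_add_inv {S : C} (j : 𝟙_ C ⟶ S) (a b : ℕ) :
    ptPow j (a + b) ≫ (tpowAdd S a b).inv = (λ_ (𝟙_ C)).inv ≫ (ptPow j a ⊗ₘ ptPow j b) := by
  rw [Iso.comp_inv_eq, Category.assoc, ptPow_add, Iso.inv_hom_id_assoc]

lemma ptPow_blocks {S : C} (j : 𝟙_ C ⟶ S) (a n b : ℕ) :
    ((ptPow j a ⊗ₘ ptPow j n) ⊗ₘ ptPow j b) ≫ (tpowBlocks S a n b).hom =
      ((λ_ (𝟙_ C)).hom ▷ 𝟙_ C) ≫ (λ_ (𝟙_ C)).hom ≫ ptPow j (a + n + b) := by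
  rw [← ptPow_add, tpowBlocks, Iso.trans_hom, whiskerRightIso_hom,
    ← MonoidalCategory.tensorHom_id, MonoidalCategory.tensorHom_comp_tensorHom_assoc, ptPow_add,
    ← MonoidalCategory.tensorHom_id, MonoidalCategory.tensorHom_comp_tensorHom_assoc,
    Category.id_comp, Category.comp_id]

lemma ptPow_slot {S : C} (j : 𝟙_ C ⟶ S) (a b : ℕ) :
    ptPow j (a + 1 + b) ≫ (tpowSlot S a b).hom =
      (λ_ (𝟙_ C)).inv ≫ ((λ_ (𝟙_ C)).inv ▷ 𝟙_ C) ≫ ((ptPow j a ⊗ₘ j) ⊗ₘ ptPow j b) := by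
  have e : ptPow j (a + 1) ⊗ₘ ptPow j b =
      ((λ_ (𝟙_ C)).inv ▷ 𝟙_ C) ≫ ((ptPow j a ⊗ₘ j) ⊗ₘ ptPow j b) := by
    rw [← MonoidalCategory.tensorHom_id, MonoidalCategory.tensorHom_comp_tensorHom,
      Category.id_comp]
    rfl
  exact (ptPow_add_inv j (a + 1) b).trans (congrArg ((λ_ (𝟙_ C)).inv ≫ ·) e)

variable [SymmetricCategory C]

/-- By naturality, exchanging two copies of the same point amounts to the braiding of the unit with
itself, which is trivial. -/
lemma ptPow_swap {S : C} (j : 𝟙_ C ⟶ S) (a b : ℕ) :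
    ptPow j (a + 2 + b) ≫ tpowSwap S a b = ptPow j (a + 2 + b) := by
  have e : ((λ_ (𝟙_ C)).inv ≫ (((λ_ (𝟙_ C)).inv ≫ (ptPow j a ⊗ₘ j)) ⊗ₘ j)) ≫
      (α_ (tpow S a) S S).hom ≫ (tpow S a ◁ (β_ S S).hom) ≫ (α_ (tpow S a) S S).inv =
      (λ_ (𝟙_ C)).inv ≫ (((λ_ (𝟙_ C)).inv ≫ (ptPow j a ⊗ₘ j)) ⊗ₘ j) := by
    have e₁ : ((λ_ (𝟙_ C)).inv ≫ (ptPow j a ⊗ₘ j)) ⊗ₘ j =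
        ((λ_ (𝟙_ C)).inv ▷ 𝟙_ C) ≫ ((ptPow j a ⊗ₘ j) ⊗ₘ j) := by
      rw [← MonoidalCategory.tensorHom_id, MonoidalCategory.tensorHom_comp_tensorHom,
        Category.id_comp]
    have e₂ : (ptPow j a ⊗ₘ (j ⊗ₘ j)) ≫ (tpow S a ◁ (β_ S S).hom) =
        ptPow j a ⊗ₘ (j ⊗ₘ j) := by
      rw [← MonoidalCategory.id_tensorHom, MonoidalCategory.tensorHom_comp_tensorHom,
        BraidedCategory.braiding_naturality, braiding_unit, Category.id_comp, Category.comp_id]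
    rw [e₁]
    simp only [Category.assoc]
    rw [MonoidalCategory.associator_naturality_assoc, reassoc_of% e₂,
      MonoidalCategory.associator_inv_naturality, Iso.hom_inv_id_assoc]
  have key (σ : tpow S (a + 2) ⟶ tpow S (a + 2)) (hσ : ptPow j (a + 2) ≫ σ = ptPow j (a + 2)) :
      ptPow j (a + 2 + b) ≫ (tpowAdd S (a + 2) b).inv ≫ (σ ▷ tpow S b) ≫
        (tpowAdd S (a + 2) b).hom = ptPow j (a + 2 + b) := by
    rw [← Category.assoc, ptPow_add_inv, Category.assoc, ← MonoidalCategory.tensorHom_id,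
      MonoidalCategory.tensorHom_comp_tensorHom_assoc, hσ, Category.comp_id, ptPow_add,
      Iso.inv_hom_id_assoc]
  exact key _ e

variable [Preadditive C] [MonoidalPreadditive C]

section

variable {S : C} {ι : Type} [Fintype ι] (j : ι → (𝟙_ C ⟶ S)) (π : ι → (S ⟶ 𝟙_ C))

/-- The points exhibit `S` as a sum of copies of the unit and `⊗` is additive, so the `A ◁ j i` are
jointly epimorphic. All cogebra axioms below are thereby checked on points. -/
lemma points_ext (total : ∑ i, π i ≫ j i = 𝟙 S) {A B : C} {f g : A ⊗ S ⟶ B}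
    (h : ∀ i, (A ◁ j i) ≫ f = (A ◁ j i) ≫ g) : f = g := by
  rw [← Category.id_comp f, ← Category.id_comp g, ← MonoidalCategory.whiskerLeft_id, ← total,
    whiskerLeft_sum, Preadditive.sum_comp, Preadditive.sum_comp]
  exact Finset.sum_congr rfl fun i _ => by
    rw [MonoidalCategory.whiskerLeft_comp, Category.assoc, Category.assoc, h]

variable {P : Operad C} (D : CommData P)

/-- The coaction for which the points `j i` are grouplike. -/
noncomputable def pointsCoact (n : ℕ) : P.obj (Fin n) ⊗ S ⟶ tpow S n :=
  ∑ i, (P.obj (Fin n) ◁ π i) ≫ (D.ε (Fin n) ▷ 𝟙_ C) ≫ (λ_ (𝟙_ C)).hom ≫ ptPow (j i) n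

variable {j π} in
lemma point_coact [DecidableEq ι] (hj : ∀ i l, j i ≫ π l = if i = l then 𝟙 (𝟙_ C) else 0)
    (i : ι) (n : ℕ) :
    (P.obj (Fin n) ◁ j i) ≫ pointsCoact j π D n =
      (D.ε (Fin n) ▷ 𝟙_ C) ≫ (λ_ (𝟙_ C)).hom ≫ ptPow (j i) n := by
  rw [pointsCoact, Preadditive.comp_sum, Finset.sum_eq_single i]
  · rw [← MonoidalCategory.whiskerLeft_comp_assoc, hj, if_pos rfl,
      MonoidalCategory.whiskerLeft_id, Category.id_comp]
  · intro l _ hl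
    rw [← MonoidalCategory.whiskerLeft_comp_assoc, hj, if_neg hl.symm,
      MonoidalPreadditive.whiskerLeft_zero, zero_comp]
  · simp

/-- The cogebra spanned by a finite set of grouplike elements. -/
noncomputable def pointsCogebra [DecidableEq ι]
    (hj : ∀ i l, j i ≫ π l = if i = l then 𝟙 (𝟙_ C) else 0)
    (total : ∑ i, π i ≫ j i = 𝟙 S) : Cogebra P where
  X := S
  coact := pointsCoact j π D
  equivariant a b := points_ext j π total fun i => by
    rw [MonoidalCategory.whisker_exchange_assoc, point_coact D hj,
      ← MonoidalCategory.comp_whiskerRight_assoc, D.map_ε, reassoc_of% (point_coact D hj i),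
      ptPow_swap]
  coact_unit := points_ext j π total fun i => by
    rw [MonoidalCategory.whisker_exchange_assoc, MonoidalCategory.whisker_exchange_assoc,
      point_coact D hj, ← MonoidalCategory.comp_whiskerRight_assoc,
      ← MonoidalCategory.comp_whiskerRight_assoc, Category.assoc, D.map_ε, D.unit_ε,
      MonoidalCategory.id_whiskerRight, Category.id_comp]
    refine (Iso.hom_inv_id_assoc _ _).trans ?_
    exact (MonoidalCategory.id_tensorHom _ _).trans (Category.comp_id _).symm
  coact_comp a b n := points_ext j π total fun i => by
    rw [MonoidalCategory.whisker_exchange_assoc, MonoidalCategory.whisker_exchange_assoc,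
      point_coact D hj, ← MonoidalCategory.comp_whiskerRight_assoc,
      ← MonoidalCategory.comp_whiskerRight_assoc, Category.assoc, D.map_ε, D.comp_ε,
      MonoidalCategory.whisker_exchange_assoc]
    have e₁ : (P.obj (Option (Fin a ⊕ Fin b)) ◁ j i) ≫ (P.map (finSlot a b) ▷ S) ≫
        pointsCoact j π D (a + 1 + b) ≫ (tpowSlot S a b).hom =
        (D.ε (Option (Fin a ⊕ Fin b)) ▷ 𝟙_ C) ≫ (λ_ (𝟙_ C)).hom ≫ (λ_ (𝟙_ C)).inv ≫
          ((λ_ (𝟙_ C)).inv ▷ 𝟙_ C) ≫ ((ptPow (j i) a ⊗ₘ j i) ⊗ₘ ptPow (j i) b) := by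
      rw [MonoidalCategory.whisker_exchange_assoc, reassoc_of% (point_coact D hj i),
        ← MonoidalCategory.comp_whiskerRight_assoc, D.map_ε, ptPow_slot]
    have e₂ : (P.obj (Fin n) ◁ ((ptPow (j i) a ⊗ₘ j i) ⊗ₘ ptPow (j i) b)) ≫
        applyAt (pointsCoact j π D n) (tpow S a) (tpow S b) ≫ (tpowBlocks S a n b).hom =
        (D.ε (Fin n) ▷ _) ≫ (λ_ _).hom ≫ ((λ_ (𝟙_ C)).hom ▷ 𝟙_ C) ≫ (λ_ (𝟙_ C)).hom ≫
          ptPow (j i) (a + n + b) := by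
      have h : ((D.ε (Fin n) ▷ 𝟙_ C) ≫ (λ_ (𝟙_ C)).hom) ≫ ptPow (j i) n =
          (P.obj (Fin n) ◁ j i) ≫ pointsCoact j π D n := by
        rw [point_coact D hj, Category.assoc]
      have u := applyAt_unit (𝟙 (𝟙_ C)) (𝟙_ C) (𝟙_ C)
      rw [Category.comp_id, MonoidalCategory.whiskerLeft_id, MonoidalCategory.id_whiskerRight,
        Category.comp_id] at u
      rw [← Category.assoc, applyAt_naturality h, Category.assoc, ptPow_blocks,
        ← whiskerRight_applyAt, Category.assoc, u]
    rw [MonoidalCategory.associator_naturality_right_assoc,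
      ← MonoidalCategory.whiskerLeft_comp_assoc, e₁]
    simp only [MonoidalCategory.whiskerLeft_comp, Category.assoc]
    rw [e₂, MonoidalCategory.whisker_exchange_assoc, MonoidalCategory.whisker_exchange_assoc,
      MonoidalCategory.whisker_exchange_assoc]
    -- After both operadic factors are augmented, their braiding is that of the unit and disappears.
    -- What then remains is coherence of unitors.
    have e₃ : ((β_ (P.obj (Option (Fin a ⊕ Fin b))) (P.obj (Fin n))).hom ▷ 𝟙_ C) ≫
        (α_ (P.obj (Fin n)) (P.obj (Option (Fin a ⊕ Fin b))) (𝟙_ C)).hom ≫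
        (P.obj (Fin n) ◁ (D.ε (Option (Fin a ⊕ Fin b)) ▷ 𝟙_ C)) ≫
        (D.ε (Fin n) ▷ (𝟙_ C ⊗ 𝟙_ C)) =
        ((D.ε (Option (Fin a ⊕ Fin b)) ⊗ₘ D.ε (Fin n)) ▷ 𝟙_ C) ≫ (α_ _ _ _).hom := by
      rw [← MonoidalCategory.associator_naturality_middle_assoc,
        ← MonoidalCategory.associator_naturality_left,
        ← MonoidalCategory.comp_whiskerRight_assoc, ← MonoidalCategory.comp_whiskerRight_assoc,
        Category.assoc, ← MonoidalCategory.tensorHom_def', ← BraidedCategory.braiding_naturality,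
        braiding_unit, Category.comp_id]
    rw [reassoc_of% e₃]
    simp only [MonoidalCategory.comp_whiskerRight, Category.assoc]
    congr 1
    simp only [← Category.assoc]
    congr 1
    monoidal

/-- The coaction on a point factors through `ε`, and `μ ≫ ε` is the identity, so the
comultiplication simply doubles the point. -/
lemma point_δ [DecidableEq ι] (hj : ∀ i l, j i ≫ π l = if i = l then 𝟙 (𝟙_ C) else 0)
    (total : ∑ i, π i ≫ j i = 𝟙 S) (i : ι) :
    j i ≫ D.δ (pointsCogebra j π D hj total) = (λ_ (𝟙_ C)).inv ≫ (j i ⊗ₘ j i) := by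
  have h : j i ≫ (λ_ S).inv ≫ (D.μ (Fin 2) ▷ S) ≫ pointsCoact j π D 2 = ptPow (j i) 2 := by
    rw [MonoidalCategory.leftUnitor_inv_naturality_assoc,
      MonoidalCategory.whisker_exchange_assoc, point_coact D hj,
      ← MonoidalCategory.comp_whiskerRight_assoc, D.μ_ε, MonoidalCategory.id_whiskerRight,
      Category.id_comp, Iso.inv_hom_id_assoc]
  have e : (((λ_ (𝟙_ C)).inv ≫ (𝟙 (𝟙_ C) ⊗ₘ j i)) ⊗ₘ j i) ≫ ((λ_ S).hom ▷ S) = j i ⊗ₘ j i := by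
    rw [← MonoidalCategory.tensorHom_id, MonoidalCategory.tensorHom_comp_tensorHom,
      MonoidalCategory.id_tensorHom, Category.assoc, MonoidalCategory.leftUnitor_naturality,
      Iso.inv_hom_id_assoc, Category.comp_id]
  exact (Category.assoc _ _ _).symm.trans ((congrArg (· ≫ ((λ_ S).hom ▷ S)) h).trans
    ((Category.assoc _ _ _).trans (congrArg ((λ_ (𝟙_ C)).inv ≫ ·) e)))

/-- Morphisms that send points to points are morphisms of cogebras. -/
noncomputable def pointsHom [DecidableEq ι]
    (hj : ∀ i l, j i ≫ π l = if i = l then 𝟙 (𝟙_ C) else 0)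
    (total : ∑ i, π i ≫ j i = 𝟙 S)
    {S' : C} {ι' : Type} [Fintype ι'] [DecidableEq ι']
    (j' : ι' → (𝟙_ C ⟶ S')) (π' : ι' → (S' ⟶ 𝟙_ C))
    (hj' : ∀ i l, j' i ≫ π' l = if i = l then 𝟙 (𝟙_ C) else 0)
    (total' : ∑ i, π' i ≫ j' i = 𝟙 S') (h : S ⟶ S') (a : ι → ι') (ha : ∀ i, j i ≫ h = j' (a i)) :
    pointsCogebra j π D hj total ⟶ pointsCogebra j' π' D hj' total' where
  hom := h
  comm n := points_ext j π total fun i => by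
    have e : (P.obj (Fin n) ◁ j i) ≫ pointsCoact j π D n ≫ tpowMap h n =
        (P.obj (Fin n) ◁ j i) ≫ (P.obj (Fin n) ◁ h) ≫ pointsCoact j' π' D n := by
      rw [reassoc_of% (point_coact D hj i), ptPow_map, ha,
        ← MonoidalCategory.whiskerLeft_comp_assoc, ha, point_coact D hj']
    exact e

end

end Grouplike

end DG

namespace DG

/-! ### Contraction of a tensor factor with a linear form -/

section Contraction

open HomologicalComplex

variable {k : Type u} [Field k]

/-- The contraction of the second factor of a tensor product of complexes
with a linear form on its part of degree `q`. -/
noncomputable def contr (M : Ch k) {K : Ch k} {q : ℤ} (f : K.X q ⟶ 𝟙_ (ModuleCat.{u} k))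
    (p n : ℤ) (h : p + q = n) : (M ⊗ K).X n ⟶ M.X p :=
  GradedObject.Monoidal.tensorObjDesc (X₁ := M.X) (X₂ := K.X) fun i j hij =>
    if hj : j = q then
      (M.X i ◁ ((K.XIsoOfEq hj).hom ≫ f)) ≫ (ρ_ _).hom ≫ (M.XIsoOfEq (by omega)).hom
    else 0

lemma ι_contr (M : Ch k) {K : Ch k} {q : ℤ} (f : K.X q ⟶ 𝟙_ (ModuleCat.{u} k))
    (p n : ℤ) (h : p + q = n) :
    ιTensorObj M K p q n h ≫ contr M f p n h = (M.X p ◁ f) ≫ (ρ_ _).hom := by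
  refine (GradedObject.Monoidal.ι_tensorObjDesc (X₁ := M.X) (X₂ := K.X) _ p q h).trans ?_
  simp

lemma ι_contr_of_ne (M : Ch k) {K : Ch k} {q : ℤ} (f : K.X q ⟶ 𝟙_ (ModuleCat.{u} k))
    (p n : ℤ) (h : p + q = n) (i j : ℤ) (hij : i + j = n) (hj : j ≠ q) :
    ιTensorObj M K i j n hij ≫ contr M f p n h = 0 := by
  refine (GradedObject.Monoidal.ι_tensorObjDesc (X₁ := M.X) (X₂ := K.X) _ i j hij).trans ?_
  simp [hj]

lemma tensorX_ext {K L : Ch k} {n : ℤ} {A : ModuleCat.{u} k} {f g : (K ⊗ L).X n ⟶ A}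
    (H : ∀ (p q : ℤ) (h : p + q = n), ιTensorObj K L p q n h ≫ f = ιTensorObj K L p q n h ≫ g) :
    f = g :=
  GradedObject.Monoidal.tensorObj_ext _ _ H

lemma whiskerRight_contr {M N : Ch k} (m : M ⟶ N) {K : Ch k} {q : ℤ}
    (f : K.X q ⟶ 𝟙_ (ModuleCat.{u} k)) (p n : ℤ) (h : p + q = n) :
    (m ▷ K).f n ≫ contr N f p n h = contr M f p n h ≫ m.f p := by
  apply tensorX_ext
  intro i j hij
  rw [← Category.assoc, ι_whiskerRight, Category.assoc, ← Category.assoc (ιTensorObj M K i j n hij)]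
  by_cases hj : j = q
  · subst hj
    obtain rfl : i = p := by omega
    rw [ι_contr, ι_contr, ← MonoidalCategory.whisker_exchange_assoc, Category.assoc,
      MonoidalCategory.rightUnitor_naturality]
  · rw [ι_contr_of_ne _ _ _ _ _ _ _ _ hj, ι_contr_of_ne _ _ _ _ _ _ _ _ hj, comp_zero, zero_comp]

lemma whiskerLeft_contr (M : Ch k) {K L : Ch k} (m : K ⟶ L) {q : ℤ}
    (f : L.X q ⟶ 𝟙_ (ModuleCat.{u} k)) (p n : ℤ) (h : p + q = n) :
    (M ◁ m).f n ≫ contr M f p n h = contr M (m.f q ≫ f) p n h := by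
  apply tensorX_ext
  intro i j hij
  rw [← Category.assoc, ι_whiskerLeft, Category.assoc]
  by_cases hj : j = q
  · subst hj
    obtain rfl : i = p := by omega
    rw [ι_contr, ι_contr, MonoidalCategory.whiskerLeft_comp_assoc]
  · rw [ι_contr_of_ne _ _ _ _ _ _ _ _ hj, ι_contr_of_ne _ _ _ _ _ _ _ _ hj, comp_zero]

lemma ι_tensor_d (K L : Ch k) {i j p q p' q' : ℤ} (h : p + q = i) (hij : j + 1 = i)
    (hp : p' + 1 = p) (hq : q' + 1 = q) :
    ιTensorObj K L p q i h ≫ (K ⊗ L).d i j =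
      (K.d p p' ▷ L.X q) ≫ ιTensorObj K L p' q j (by omega) +
      p.negOnePow • ((K.X p ◁ L.d q q') ≫ ιTensorObj K L p q' j (by omega)) := by
  obtain rfl : p' = p - 1 := by omega
  obtain rfl : q' = q - 1 := by omega
  exact ι_d K L i j p q h hij

/-- A Leibniz rule. Only the summands of bidegree `(1, 0)` and `(0, 1)` contribute; the Koszul sign
on the second is `(-1)^0`. -/
lemma contr_d (M : Ch k) {K : Ch k} (f : K.X 0 ⟶ 𝟙_ (ModuleCat.{u} k)) :
    (M ⊗ K).d 1 0 ≫ contr M f 0 0 (by simp) =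
      contr M f 1 1 (by simp) ≫ M.d 1 0 + contr M (K.d 1 0 ≫ f) 0 1 (by simp) := by
  apply tensorX_ext
  intro i j hij
  rw [Preadditive.comp_add, ← Category.assoc, ← Category.assoc]
  by_cases hj : j = 0
  · subst hj
    obtain rfl : i = 1 := by omega
    rw [ι_tensor_d M K hij (zero_add 1) (zero_add 1) (neg_add_cancel 1), Preadditive.add_comp,
      Linear.units_smul_comp, Category.assoc, Category.assoc, ι_contr, ι_contr,
      ι_contr_of_ne _ _ _ _ _ _ _ _ (show (0:ℤ) ≠ 1 by simp),
      ι_contr_of_ne _ _ _ _ _ _ _ _ (show (-1:ℤ) ≠ 0 by simp), comp_zero, smul_zero,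
      Category.assoc, ← MonoidalCategory.rightUnitor_naturality,
      MonoidalCategory.whisker_exchange_assoc]
  by_cases hj' : j = 1
  · subst hj'
    obtain rfl : i = 0 := by omega
    rw [ι_tensor_d M K hij (zero_add 1) (neg_add_cancel 1) (zero_add 1), Preadditive.add_comp,
      Linear.units_smul_comp, Category.assoc, Category.assoc, ι_contr, ι_contr,
      ι_contr_of_ne _ _ _ _ _ _ _ _ (show (1:ℤ) ≠ 0 by simp),
      ι_contr_of_ne _ _ _ _ _ _ _ _ (show (1:ℤ) ≠ 0 by simp), comp_zero, zero_comp, zero_add,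
      zero_add, Int.negOnePow_zero, one_smul, MonoidalCategory.whiskerLeft_comp_assoc]
  · rw [ι_tensor_d M K hij (zero_add 1) (sub_add_cancel i 1) (sub_add_cancel j 1),
      Preadditive.add_comp, Linear.units_smul_comp, Category.assoc, Category.assoc,
      ι_contr_of_ne _ _ _ _ _ _ _ _ hj, ι_contr_of_ne _ _ _ _ _ _ _ _ hj,
      ι_contr_of_ne _ _ _ _ _ _ _ _ hj', ι_contr_of_ne _ _ _ _ _ _ _ _ (by omega)]
    simp

/-- Only the summand of degrees `(p, i, j)` in `M`, `K`, `L` survives on either side, and there both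
are evaluation of `g` and `f` on the last two factors. With coassociativity this makes contractions
multiplicative. -/
lemma contr_contr (M K L : Ch k) {i j p n a b : ℤ} (f : L.X j ⟶ 𝟙_ (ModuleCat.{u} k))
    (g : K.X i ⟶ 𝟙_ (ModuleCat.{u} k)) (h₁ : a + j = n) (h₂ : p + i = a) (h₃ : i + j = b)
    (h₄ : p + b = n) :
    contr (M ⊗ K) f a n h₁ ≫ contr M g p a h₂ =
      (α_ M K L).hom.f n ≫ contr M (contr K f i b h₃ ≫ g) p n h₄ := by
  refine GradedObject.Monoidal.tensorObj₃'_ext (X₁ := M.X) (X₂ := K.X) (X₃ := L.X) _ _ ?_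
  intro x y z hxyz
  have e₁ : GradedObject.Monoidal.ιTensorObj₃' M.X K.X L.X x y z n hxyz =
    (ιTensorObj M K x y (x + y) rfl ▷ L.X z) ≫ ιTensorObj (M ⊗ K) L (x + y) z n hxyz :=
    GradedObject.Monoidal.ιTensorObj₃'_eq M.X K.X L.X x y z n hxyz _ rfl
  have e₂ : GradedObject.Monoidal.ιTensorObj₃ M.X K.X L.X x y z n hxyz =
    (M.X x ◁ ιTensorObj K L y z (y + z) rfl) ≫ ιTensorObj M (K ⊗ L) x (y + z) n (by omega) :=
    GradedObject.Monoidal.ιTensorObj₃_eq M.X K.X L.X x y z n hxyz _ rfl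
  have e₃ : GradedObject.Monoidal.ιTensorObj₃' M.X K.X L.X x y z n hxyz ≫
      (α_ M K L).hom.f n = (α_ _ _ _).hom ≫
        GradedObject.Monoidal.ιTensorObj₃ M.X K.X L.X x y z n hxyz :=
    GradedObject.Monoidal.ιTensorObj₃'_associator_hom M.X K.X L.X x y z n hxyz
  obtain ⟨u, hu⟩ : ∃ u : M.X x ⊗ K.X y ⟶ (M ⊗ K).X (x + y),
    u = ιTensorObj M K x y (x + y) rfl := ⟨_, rfl⟩
  obtain ⟨v, hv⟩ : ∃ v : K.X y ⊗ L.X z ⟶ (K ⊗ L).X (y + z),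
    v = ιTensorObj K L y z (y + z) rfl := ⟨_, rfl⟩
  rw [← hu] at e₁
  rw [← hv] at e₂
  suffices key : (u ▷ L.X z) ≫
      ιTensorObj (M ⊗ K) L (x + y) z n hxyz ≫ contr (M ⊗ K) f a n h₁ ≫ contr M g p a h₂ =
      (α_ _ _ _).hom ≫ (M.X x ◁ v) ≫
        ιTensorObj M (K ⊗ L) x (y + z) n (by omega) ≫ contr M (contr K f i b h₃ ≫ g) p n h₄ from
    ((congrArg (· ≫ contr (M ⊗ K) f a n h₁ ≫ contr M g p a h₂) e₁).trans
      ((Category.assoc _ _ _).trans key)).trans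
      (((congrArg (· ≫ contr M (contr K f i b h₃ ≫ g) p n h₄)
        (e₃.trans (congrArg ((α_ _ _ _).hom ≫ ·) e₂))).trans ((Category.assoc _ _ _).trans
        (congrArg ((α_ _ _ _).hom ≫ ·) (Category.assoc _ _ _)))).symm.trans
      (Category.assoc _ _ _))
  rw [← Category.assoc (ιTensorObj (M ⊗ K) L (x + y) z n hxyz)]
  by_cases hz : z = j
  · subst hz
    obtain rfl : a = x + y := by omega
    rw [ι_contr, Category.assoc, ← MonoidalCategory.whisker_exchange_assoc,
      MonoidalCategory.rightUnitor_naturality_assoc]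
    by_cases hy : y = i
    · subst hy
      obtain rfl : b = y + z := by omega
      obtain rfl : x = p := by omega
      have eu : u ≫ contr M g x (x + y) h₂ = (M.X x ◁ g) ≫ (ρ_ _).hom := by rw [hu, ι_contr]
      have ev : v ≫ contr K f y (y + z) h₃ = (K.X y ◁ f) ≫ (ρ_ _).hom := by rw [hv, ι_contr]
      rw [eu, ι_contr, ← MonoidalCategory.whiskerLeft_comp_assoc, reassoc_of% ev]
      simp
    · have eu : u ≫ contr M g p (x + y) h₂ = 0 := by rw [hu, ι_contr_of_ne _ _ _ _ _ _ _ _ hy]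
      rw [eu, ι_contr_of_ne _ _ _ _ _ _ _ _ (by omega)]
      simp
  · rw [ι_contr_of_ne _ _ _ _ _ _ _ _ hz]
    by_cases hb : y + z = b
    · subst hb
      obtain rfl : x = p := by omega
      have ev : v ≫ contr K f i (y + z) h₃ = 0 := by rw [hv, ι_contr_of_ne _ _ _ _ _ _ _ _ hz]
      rw [ι_contr, ← MonoidalCategory.whiskerLeft_comp_assoc, reassoc_of% ev]
      simp
    · rw [ι_contr_of_ne _ _ _ _ _ _ _ _ hb]
      simp

lemma braid_contr (K L : Ch k) {i j n : ℤ} (f : L.X j ⟶ 𝟙_ (ModuleCat.{u} k))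
    (g : K.X i ⟶ 𝟙_ (ModuleCat.{u} k)) (h : i + j = n) (h' : j + i = n) :
    (β_ K L).hom.f n ≫ contr L g j n h' ≫ f = (i * j).negOnePow • (contr K f i n h ≫ g) := by
  apply tensorX_ext
  intro p q hpq
  refine (Category.assoc _ _ _).symm.trans
    ((congrArg (· ≫ contr L g j n h' ≫ f) (ι_braid K L p q n hpq)).trans ?_)
  rw [Linear.comp_units_smul, ← Category.assoc (ιTensorObj K L p q n hpq), Linear.units_smul_comp,
    Category.assoc]
  by_cases hq : q = j
  · subst hq
    obtain rfl : p = i := by omega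
    rw [ι_contr, ← Category.assoc (ιTensorObj L K _ _ _ _), ι_contr, Category.assoc,
      Category.assoc, ← MonoidalCategory.rightUnitor_naturality,
      ← MonoidalCategory.rightUnitor_naturality, MonoidalCategory.whisker_exchange_assoc,
      ← BraidedCategory.braiding_naturality_right_assoc,
      ← BraidedCategory.braiding_naturality_left_assoc, braiding_unit, Category.id_comp]
  · rw [ι_contr_of_ne _ _ _ _ _ _ _ _ hq, ← Category.assoc (ιTensorObj L K _ _ _ _),
      ι_contr_of_ne _ _ _ _ _ _ _ _ (by omega)]
    simp

end Contraction

end DG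

namespace DG

/-! ### Polynomials in an operator that commutes with its commutator with `d` -/

section LinearAlgebra

open Polynomial

variable {k V₁ V₀ : Type*} [Field k] [AddCommGroup V₁] [Module k V₁] [AddCommGroup V₀] [Module k V₀]

lemma aeval_apply_of_eigen {T : Module.End k V₀} {v : V₀} {c : k} (h : T v = c • v) (q : k[X]) :
    aeval T q v = q.eval c • v := by
  induction q using Polynomial.induction_on' with
  | add p q hp hq => simp [hp, hq, add_smul]
  | monomial n a =>
    have : (T ^ n) v = c ^ n • v := by
      induction n with
      | zero => simp
      | succ n ih => rw [pow_succ, Module.End.mul_apply, h, map_smul, ih, smul_smul, pow_succ,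
          mul_comm]
    simp [aeval_monomial, this, smul_smul, mul_comm]

lemma aeval_intertwine {T₁ : Module.End k V₁} {T₀ : Module.End k V₀} {D : V₁ →ₗ[k] V₀}
    (h : ∀ w, T₀ (D w) = D (T₁ w)) (q : k[X]) (w : V₁) : aeval T₀ q (D w) = D (aeval T₁ q w) := by
  induction q using Polynomial.induction_on' with
  | add p q hp hq => simp [hp, hq]
  | monomial n a =>
    have : ∀ w, (T₀ ^ n) (D w) = D ((T₁ ^ n) w) := by
      induction n with
      | zero => simp
      | succ n ih => intro w; rw [pow_succ, Module.End.mul_apply, h, ih, pow_succ]; rfl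
    simp [aeval_monomial, this]

/-- If `D = T₀ d - d T₁` commutes with the operators `Tᵢ`, then `d` commutes with `q(Tᵢ)`
up to `q'(T₀) D`. -/
lemma aeval_derivative {T₁ : Module.End k V₁} {T₀ : Module.End k V₀} {d D : V₁ →ₗ[k] V₀}
    (hD : ∀ w, T₀ (d w) = d (T₁ w) + D w) (h : ∀ w, T₀ (D w) = D (T₁ w)) (q : k[X]) (w : V₁) :
    aeval T₀ q (d w) = d (aeval T₁ q w) + aeval T₀ (derivative q) (D w) := by
  induction q using Polynomial.induction_on with
  | C a => simp [Module.algebraMap_end_apply]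
  | add p q hp hq => simp only [map_add, LinearMap.add_apply, hp, hq]; abel
  | monomial n a ih =>
    have e : (C a * X ^ (n + 1) : k[X]) = X * (C a * X ^ n) := by ring
    rw [e]
    generalize (C a * X ^ n : k[X]) = q at ih
    rw [derivative_mul, derivative_X, one_mul, map_mul, map_mul, aeval_X, aeval_X, map_add,
      map_mul, aeval_X, Module.End.mul_apply, Module.End.mul_apply, ih, map_add, hD,
      LinearMap.add_apply, Module.End.mul_apply, aeval_intertwine h q w]
    abel

/-- The factor `X` is there because only the positive powers of `T` are controlled by `S`. -/
lemma exists_aeval_X_mul_eq_zero (T : Module.End k V₀) (v : V₀) (S : Submodule k V₀)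
    [FiniteDimensional k S] (hS : ∀ n : ℕ, (T ^ (n + 1)) v ∈ S) :
    ∃ p : k[X], p ≠ 0 ∧ aeval T (X * p) v = 0 := by
  have hmem (p : k[X]) : aeval T (X * p) v ∈ S := by
    induction p using Polynomial.induction_on' with
    | add p q hp hq =>
      rw [mul_add, map_add]
      exact S.add_mem hp hq
    | monomial n a =>
      rw [X_mul_monomial, aeval_monomial]
      exact S.smul_mem a (hS n)
  let Φ : k[X] →ₗ[k] S :=
    { toFun p := ⟨aeval T (X * p) v, hmem p⟩
      map_add' p q := Subtype.ext (by simp [mul_add])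
      map_smul' a p := Subtype.ext (by simp) }
  -- `k[X]` is infinite-dimensional and `S` is not.
  have hΦ : ¬ Function.Injective Φ := fun hinj =>
    Polynomial.not_finite (R := k) (Module.Finite.of_injective Φ hinj)
  rw [← LinearMap.ker_eq_bot, Submodule.eq_bot_iff] at hΦ
  push Not at hΦ
  obtain ⟨p, hp, hp0⟩ := hΦ
  exact ⟨p, hp0, congrArg Subtype.val hp⟩

/-- For a non-zero polynomial `p`, there is a polynomial that takes the values `0` and `1`
at `0` and `1`, and whose derivative is a multiple of `X p`. -/
lemma exists_separating_polynomial {p : k[X]} (hp : p ≠ 0) :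
    ∃ q : k[X], q.eval 0 = 0 ∧ q.eval 1 = 1 ∧ X * p ∣ derivative q := by
  have hXp : X * p ≠ 0 := mul_ne_zero X_ne_zero hp
  obtain ⟨s, hs, hs1⟩ := exists_eq_pow_rootMultiplicity_mul_and_not_dvd (X * p) hXp 1
  -- Now `X p = (X - 1)^b s` with `s(1) ≠ 0`. Also `s(0) = 0`, since `X - 1` does not vanish at `0`.
  generalize rootMultiplicity 1 (X * p) = b at hs
  have hs0 : s.eval 0 = 0 := by
    have h := congrArg (eval 0) hs
    simp only [eval_mul, eval_X, zero_mul, eval_pow, eval_sub, eval_C, zero_sub] at h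
    exact (mul_eq_zero.mp h.symm).resolve_left (pow_ne_zero _ (by simp))
  have hcop : IsCoprime (X - C (1 : k)) s := (irreducible_X_sub_C 1).coprime_iff_not_dvd.mpr hs1
  -- The witness `q = v s²` is `0` modulo `s²` and `1` modulo `(X - 1)^(b + 1)`. The exponents
  -- exceed what is needed because differentiation may lower each order of vanishing by one.
  obtain ⟨u, v, huv⟩ : IsCoprime ((X - C (1 : k)) ^ (b + 1)) (s ^ 2) := hcop.pow
  refine ⟨v * s ^ 2, by simp [hs0], ?_, ?_⟩
  · have h := congrArg (eval 1) huv
    simpa using h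
  · rw [hs]
    refine IsCoprime.mul_dvd hcop.pow_left ?_ ?_
    · have e : v * s ^ 2 = 1 - u * (X - C (1 : k)) ^ (b + 1) := by rw [← huv]; ring
      rw [e, derivative_sub, derivative_one, derivative_mul, derivative_pow, zero_sub, dvd_neg]
      refine dvd_add (Dvd.dvd.mul_left (pow_dvd_pow _ (Nat.le_succ b)) _) ?_
      refine Dvd.dvd.mul_left ?_ _
      rw [Nat.add_sub_cancel]
      exact ⟨C ((b + 1 : ℕ) : k) * derivative (X - C 1), by ring⟩
    · rw [derivative_mul, derivative_pow]
      refine dvd_add ⟨derivative v * s, by ring⟩ ⟨v * C 2 * derivative s, ?_⟩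
      simp
      ring

/-- For a separating polynomial `q`, the operator `q(T₀)` fixes `e₁` and kills `e₀`, while the error
term `q'(T₀) D w` vanishes. So `q(T₁) w` is a primitive of `e₁`. -/
lemma mem_range_of_eigen {T₁ : Module.End k V₁} {T₀ : Module.End k V₀} {d D : V₁ →ₗ[k] V₀}
    (hD : ∀ w, T₀ (d w) = d (T₁ w) + D w) (h : ∀ w, T₀ (D w) = D (T₁ w)) {w : V₁} {e₀ e₁ : V₀}
    (hw : d w = e₁ - e₀) (h₁ : T₀ e₁ = e₁) (h₀ : T₀ e₀ = 0) (S : Submodule k V₀)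
    [FiniteDimensional k S] (hS : ∀ n : ℕ, (T₀ ^ (n + 1)) (D w) ∈ S) : ∃ v, d v = e₁ := by
  obtain ⟨p, hp, hpw⟩ := exists_aeval_X_mul_eq_zero T₀ (D w) S hS
  obtain ⟨q, hq₀, hq₁, r, hr⟩ := exists_separating_polynomial hp
  refine ⟨aeval T₁ q w, ?_⟩
  have e := aeval_derivative hD h q w
  rw [hr, mul_comm, map_mul, Module.End.mul_apply, hpw, map_zero, add_zero, hw, map_sub,
    aeval_apply_of_eigen (c := 1) (by rw [h₁, one_smul]),
    aeval_apply_of_eigen (c := 0) (by rw [h₀, zero_smul]), hq₀, hq₁, one_smul, zero_smul,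
    sub_zero] at e
  exact e.symm

end LinearAlgebra

end DG

namespace DG

/-! ### The action of linear forms on a cocommutative cogebra -/

section Action

open HomologicalComplex

variable {k : Type u} [Field k]

/-- A tensor is a finite sum of pure tensors `x ⊗ y`, and every contraction of `x ⊗ y` is a multiple
of `x`. The space `S` thus serves all forms `f` simultaneously. -/
lemma contr_finite (M : Ch k) {K : Ch k} {q : ℤ} (p n : ℤ) (h : p + q = n) (u : (M ⊗ K).X n) :
    ∃ S : Submodule k (M.X p), FiniteDimensional k S ∧
      ∀ f : K.X q ⟶ 𝟙_ (ModuleCat.{u} k), (contr M f p n h).hom u ∈ S := by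
  let N : Submodule k ((M ⊗ K).X n) :=
    { carrier := {u | ∃ S : Submodule k (M.X p), FiniteDimensional k S ∧
        ∀ f : K.X q ⟶ 𝟙_ (ModuleCat.{u} k), (contr M f p n h).hom u ∈ S}
      zero_mem' := ⟨⊥, inferInstance, fun f => by simp⟩
      add_mem' := by
        rintro a b ⟨S, _, hS⟩ ⟨T, _, hT⟩
        refine ⟨S ⊔ T, inferInstance, fun f => ?_⟩
        rw [map_add]
        exact Submodule.add_mem_sup (hS f) (hT f)
      smul_mem' := by
        rintro c a ⟨S, hS, hS'⟩
        refine ⟨S, hS, fun f => ?_⟩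
        rw [map_smul]
        exact S.smul_mem c (hS' f) }
  have hN (i j : ℤ) (hij : i + j = n) (t : (M.X i ⊗ K.X j : ModuleCat.{u} k)) :
      (ιTensorObj M K i j n hij).hom t ∈ N := by
    induction t using TensorProduct.induction_on with
    | zero => rw [map_zero]; exact N.zero_mem
    | add a b ha hb => rw [map_add]; exact N.add_mem ha hb
    | tmul x y =>
      by_cases hj : j = q
      · subst hj
        obtain rfl : i = p := by omega
        refine ⟨Submodule.span k {x}, inferInstance, fun f => ?_⟩
        have e := congrArg (fun t => t.hom (x ⊗ₜ[k] y)) (ι_contr M f i n h)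
        refine (congrArg (· ∈ Submodule.span k {x}) e).mpr ?_
        exact Submodule.smul_mem _ (f.hom y) (Submodule.mem_span_singleton_self x)
      · refine ⟨⊥, inferInstance, fun f => ?_⟩
        have e := congrArg (fun t => t.hom (x ⊗ₜ[k] y)) (ι_contr_of_ne M f p n h i j hij hj)
        exact (Submodule.mem_bot k).mpr e
  -- The projection modulo `N` vanishes on each summand of the tensor product, hence everywhere.
  have hz : ModuleCat.ofHom N.mkQ = 0 := by
    apply tensorX_ext
    intro i j hij
    ext t
    simpa using hN i j hij t
  have : N.mkQ u = 0 := congrArg (fun t => t.hom u) hz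
  exact (Submodule.Quotient.mk_eq_zero N).mp this

variable {X : Ch k} (δ : X ⟶ X ⊗ X)

/-- The action of linear forms on a cogebra with comultiplication `δ`. -/
noncomputable def act {q : ℤ} (f : X.X q ⟶ 𝟙_ (ModuleCat.{u} k)) (p n : ℤ) (h : p + q = n) :
    X.X n ⟶ X.X p :=
  δ.f n ≫ contr X f p n h

variable {δ}

/-- Coassociativity: the composite of two actions is the action of the convolution product of the
forms. -/
lemma act_comp (ha : δ ≫ (δ ▷ X) ≫ (α_ X X X).hom = δ ≫ (X ◁ δ)) {i j p n a b : ℤ}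
    (f : X.X j ⟶ 𝟙_ (ModuleCat.{u} k)) (g : X.X i ⟶ 𝟙_ (ModuleCat.{u} k))
    (h₁ : a + j = n) (h₂ : p + i = a) (h₃ : i + j = b) (h₄ : p + b = n) :
    act δ f a n h₁ ≫ act δ g p a h₂ = act δ (act δ f i b h₃ ≫ g) p n h₄ := by
  have ha' := congrArg (fun t => t.f n) ha
  simp only [HomologicalComplex.comp_f] at ha'
  rw [act, act, act, act, Category.assoc, ← Category.assoc (contr X f a n h₁),
    ← whiskerRight_contr, Category.assoc, contr_contr X X X f g h₁ h₂ h₃ h₄, reassoc_of% ha',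
    whiskerLeft_contr, Category.assoc]

/-- Cocommutativity makes the convolution product of linear forms graded commutative. -/
lemma act_comm (hc : δ ≫ (β_ X X).hom = δ) {i j n : ℤ} (f : X.X j ⟶ 𝟙_ (ModuleCat.{u} k))
    (g : X.X i ⟶ 𝟙_ (ModuleCat.{u} k)) (h : i + j = n) (h' : j + i = n) :
    act δ g j n h' ≫ f = (i * j).negOnePow • (act δ f i n h ≫ g) := by
  have hc' : δ.f n ≫ (β_ X X).hom.f n = δ.f n := congrArg (fun t => t.f n) hc
  rw [act, ← hc', Category.assoc, Category.assoc, braid_contr, Linear.comp_units_smul, act,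
    Category.assoc]

lemma act_d (f : X.X 0 ⟶ 𝟙_ (ModuleCat.{u} k)) :
    X.d 1 0 ≫ act δ f 0 0 (add_zero 0) =
      act δ f 1 1 (add_zero 1) ≫ X.d 1 0 + act δ (X.d 1 0 ≫ f) 0 1 (zero_add 1) := by
  rw [act, ← HomologicalComplex.Hom.comm_assoc, contr_d, Preadditive.comp_add, act, act,
    Category.assoc]

/-- The exponent starts at `1`: without a counit, the identity need not be the action of a linear
form. -/
lemma act_pow (ha : δ ≫ (δ ▷ X) ≫ (α_ X X X).hom = δ ≫ (X ◁ δ))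
    (f : X.X 0 ⟶ 𝟙_ (ModuleCat.{u} k)) (n : ℕ) :
    ∃ g : X.X 0 ⟶ 𝟙_ (ModuleCat.{u} k),
      ((act δ f 0 0 (add_zero 0)).hom : Module.End k (X.X 0)) ^ (n + 1) =
        (act δ g 0 0 (add_zero 0)).hom := by
  induction n with
  | zero => exact ⟨f, pow_one _⟩
  | succ n ih =>
    obtain ⟨g, hg⟩ := ih
    refine ⟨act δ f 0 0 (add_zero 0) ≫ g, ?_⟩
    rw [pow_succ, hg, ← act_comp ha f g (add_zero 0) (add_zero 0) (add_zero 0) (add_zero 0)]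
    rfl

variable (k) in
/-- The degree zero part of the unit complex is the ground field. -/
noncomputable def unitForm : (𝟙_ (Ch k)).X 0 ≅ 𝟙_ (ModuleCat.{u} k) :=
  singleObjXSelf (ComplexShape.down ℤ) 0 (𝟙_ (ModuleCat.{u} k))

/-- As `e` is grouplike, contracting `e ⊗ e` with `f` gives `f(e) e`: a grouplike element is an
eigenvector of every action. -/
lemma act_point {e : 𝟙_ (Ch k) ⟶ X} (he : e ≫ δ = (λ_ (𝟙_ (Ch k))).inv ≫ (e ⊗ₘ e))
    (f : X.X 0 ⟶ 𝟙_ (ModuleCat.{u} k)) :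
    e.f 0 ≫ act δ f 0 0 (add_zero 0) = e.f 0 ≫ f ≫ (unitForm k).inv ≫ e.f 0 := by
  have he' := congrArg (fun t => t.f 0) he
  simp only [MonoidalCategory.tensorHom_def', HomologicalComplex.comp_f] at he'
  have hl : (λ_ (𝟙_ (Ch k))).inv.f 0 = (λ_ _).inv ≫ ((unitForm k).inv ▷ (𝟙_ (Ch k)).X 0) ≫
      ιTensorObj (𝟙_ (Ch k)) (𝟙_ (Ch k)) 0 0 0 (add_zero 0) :=
    leftUnitor'_inv (𝟙_ (Ch k)) 0
  have hφ (φ : (𝟙_ (Ch k)).X 0 ⟶ 𝟙_ (ModuleCat.{u} k)) :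
      (λ_ (𝟙_ (Ch k))).inv.f 0 ≫ contr (𝟙_ (Ch k)) φ 0 0 (add_zero 0) =
        φ ≫ (unitForm k).inv := by
    rw [hl, Category.assoc, Category.assoc, ι_contr, ← MonoidalCategory.whisker_exchange_assoc,
      MonoidalCategory.rightUnitor_naturality, ← unitors_equal,
      MonoidalCategory.leftUnitor_naturality_assoc, Iso.inv_hom_id_assoc]
  rw [act, reassoc_of% he', whiskerRight_contr, ← Category.assoc ((_ ◁ e).f 0),
    whiskerLeft_contr, ← Category.assoc, hφ]
  simp only [Category.assoc]

/-- In a cocommutative dg cogebra, two grouplike elements that are separated by a linear form are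
homologous only if they are boundaries. -/
lemma exists_d_eq_of_homologous (hc : δ ≫ (β_ X X).hom = δ)
    (ha : δ ≫ (δ ▷ X) ≫ (α_ X X X).hom = δ ≫ (X ◁ δ)) {e₀ e₁ : 𝟙_ (Ch k) ⟶ X}
    (h₀ : e₀ ≫ δ = (λ_ (𝟙_ (Ch k))).inv ≫ (e₀ ⊗ₘ e₀))
    (h₁ : e₁ ≫ δ = (λ_ (𝟙_ (Ch k))).inv ≫ (e₁ ⊗ₘ e₁)) (f : X.X 0 ⟶ 𝟙_ (ModuleCat.{u} k))
    (hf₀ : e₀.f 0 ≫ f = 0) (hf₁ : e₁.f 0 ≫ f = (unitForm k).hom) (x : (𝟙_ (Ch k)).X 0)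
    (w : X.X 1) (hw : (X.d 1 0).hom w = (e₁.f 0).hom x - (e₀.f 0).hom x) :
    ∃ v : X.X 1, (X.d 1 0).hom v = (e₁.f 0).hom x := by
  set T₀ := act δ f 0 0 (add_zero 0) with hT₀
  set T₁ := act δ f 1 1 (add_zero 1) with hT₁
  set D := act δ (X.d 1 0 ≫ f) 0 1 (zero_add 1) with hD
  -- Both composites are actions of convolution products of `f` and `f ∘ d`, in the two orders. The
  -- Koszul sign is trivial because `f` has degree `0`.
  have hcomm : D ≫ T₀ = T₁ ≫ D := by
    rw [hD, hT₀, hT₁, act_comp ha _ _ (zero_add 1) (add_zero 0) (zero_add 1) (zero_add 1),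
      act_comp ha _ _ (add_zero 1) (zero_add 1) (add_zero 1) (zero_add 1),
      act_comm hc f (X.d 1 0 ≫ f) (add_zero 1) (zero_add 1), mul_zero, Int.negOnePow_zero,
      one_smul]
  have hd : X.d 1 0 ≫ T₀ = T₁ ≫ X.d 1 0 + D := act_d f
  -- One tensor, `δ (D w)`, bounds all the iterates, since each `T₀^(n+1)` is itself the action of a
  -- form.
  obtain ⟨S, _, hS⟩ := contr_finite X (K := X) 0 0 (add_zero 0) ((δ.f 0).hom (D.hom w))
  refine mem_range_of_eigen (T₁ := T₁.hom) (T₀ := T₀.hom) (d := (X.d 1 0).hom) (D := D.hom)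
    (fun w => congrArg (fun t => t.hom w) hd) (fun w => congrArg (fun t => t.hom w) hcomm) hw
    ?_ ?_ S fun n => ?_
  · have e := act_point h₁ f
    rw [reassoc_of% hf₁, Iso.hom_inv_id_assoc] at e
    exact congrArg (fun t => t.hom x) e
  · have e := act_point h₀ f
    rw [reassoc_of% hf₀, zero_comp] at e
    exact congrArg (fun t => t.hom x) e
  · obtain ⟨g, hg⟩ := act_pow ha f n
    rw [hT₀, hg]
    exact hS g

end Action

/-! ### Cycles killed by a quasi-isomorphism -/

section Homology

variable {k : Type u} [Field k]

/-- A quasi-isomorphism is injective on homology, so a cycle with image zero is a boundary. -/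
lemma exists_d_eq_of_quasiIso {K L : Ch k} (p : K ⟶ L) [QuasiIso p] (e : 𝟙_ (Ch k) ⟶ K)
    (he : e ≫ p = 0) (x : (𝟙_ (Ch k)).X 0) :
    ∃ w : K.X 1, (K.d 1 0).hom w = (e.f 0).hom x := by
  have hprev : (ComplexShape.down ℤ).prev 0 = 1 := ComplexShape.prev_eq' _ (by simp)
  have hnext : (ComplexShape.down ℤ).next 0 = -1 := ComplexShape.next_eq' _ (by simp)
  have hd : e.f 0 ≫ K.d 0 (-1) = 0 := by
    rw [e.comm]
    exact zero_comp
  have h : K.liftCycles (e.f 0) (-1) hnext hd ≫ K.homologyπ 0 = 0 := by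
    rw [← cancel_mono (HomologicalComplex.homologyMap p 0), Category.assoc,
      HomologicalComplex.homologyπ_naturality, HomologicalComplex.liftCycles_comp_cyclesMap_assoc,
      zero_comp]
    have : e.f 0 ≫ p.f 0 = 0 := congrArg (fun t => t.f 0) he
    have h0 : L.liftCycles (e.f 0 ≫ p.f 0) (-1) hnext (by rw [this, zero_comp]) = 0 := by
      rw [← cancel_mono (L.iCycles 0), HomologicalComplex.liftCycles_i, zero_comp, this]
    rw [h0, zero_comp]
  -- A primitive exists after pulling back along an epimorphism `π`; surjectivity of `π` provides a
  -- preimage of `x`.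
  obtain ⟨A, π, hπ, y, hy⟩ :=
    (K.liftCycles_comp_homologyπ_eq_zero_iff_up_to_refinements 1 0 (-1) hprev hnext _ hd).mp h
  obtain ⟨a, rfl⟩ := (ModuleCat.epi_iff_surjective π).mp hπ x
  exact ⟨y.hom a, (congrArg (fun t => t.hom a) hy).symm⟩

end Homology

/-! ### Absence of a cylinder object -/

section Main

open HomotopicalAlgebra

variable {k : Type u} [Field k]

/-- The fold map of two grouplike elements has no factorization as an injective map followed
by a quasi-isomorphism through a cocommutative dg cogebra. -/
lemma no_cylinder {X : Ch k} (δ : X ⟶ X ⊗ X) (hc : δ ≫ (β_ X X).hom = δ)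
    (ha : δ ≫ (δ ▷ X) ≫ (α_ X X X).hom = δ ≫ (X ◁ δ)) (i : 𝟙_ (Ch k) ⊞ 𝟙_ (Ch k) ⟶ X)
    (p : X ⟶ 𝟙_ (Ch k)) (hi : Mono (i.f 0)) (hp : QuasiIso p)
    (fac : i ≫ p = biprod.desc (𝟙 _) (𝟙 _))
    (h₀ : (biprod.inl ≫ i) ≫ δ = (λ_ (𝟙_ (Ch k))).inv ≫ ((biprod.inl ≫ i) ⊗ₘ (biprod.inl ≫ i)))
    (h₁ : (biprod.inr ≫ i) ≫ δ = (λ_ (𝟙_ (Ch k))).inv ≫ ((biprod.inr ≫ i) ⊗ₘ (biprod.inr ≫ i))) :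
    False := by
  obtain ⟨r, hr⟩ := LinearMap.exists_leftInverse_of_injective (i.f 0).hom
    (LinearMap.ker_eq_bot.mpr ((ModuleCat.mono_iff_injective _).mp hi))
  have hr' : i.f 0 ≫ ModuleCat.ofHom r = 𝟙 _ := ModuleCat.hom_ext hr
  have h₀p : (biprod.inl ≫ i) ≫ p = 𝟙 _ := by rw [Category.assoc, fac, biprod.inl_desc]
  have h₁p : (biprod.inr ≫ i) ≫ p = 𝟙 _ := by rw [Category.assoc, fac, biprod.inr_desc]
  -- The second coordinate of a linear retraction of `i` in degree `0` separates the two points. It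
  -- is only a linear form and need not extend to a chain map.
  let f : X.X 0 ⟶ 𝟙_ (ModuleCat.{u} k) :=
    ModuleCat.ofHom r ≫ (biprod.snd : 𝟙_ (Ch k) ⊞ 𝟙_ (Ch k) ⟶ _).f 0 ≫ (unitForm k).hom
  have hf₀ : (biprod.inl ≫ i).f 0 ≫ f = 0 := by
    rw [HomologicalComplex.comp_f, Category.assoc, reassoc_of% hr',
      ← HomologicalComplex.comp_f_assoc, biprod.inl_snd, HomologicalComplex.zero_f, zero_comp]
  have hf₁ : (biprod.inr ≫ i).f 0 ≫ f = (unitForm k).hom := by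
    rw [HomologicalComplex.comp_f, Category.assoc, reassoc_of% hr',
      ← HomologicalComplex.comp_f_assoc, biprod.inr_snd, HomologicalComplex.id_f,
      Category.id_comp]
  let x : (𝟙_ (Ch k)).X 0 := (unitForm k).inv.hom (1 : k)
  obtain ⟨w, hw⟩ := exists_d_eq_of_quasiIso p (biprod.inr ≫ i - biprod.inl ≫ i)
    (by rw [Preadditive.sub_comp, h₀p, h₁p, sub_self]) x
  obtain ⟨v, hv⟩ := exists_d_eq_of_homologous hc ha h₀ h₁ f hf₀ hf₁ x w hw
  have hd : (𝟙_ (Ch k)).d 1 0 = 0 := HomologicalComplex.single_obj_d _ _ _ _ _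
  have hx : (p.f 0).hom (((biprod.inr ≫ i).f 0).hom x) = x :=
    congrArg (fun t => (t.f 0).hom x) h₁p
  -- If `e₁ = d v`, then `p e₁ = d (p v) = 0`, as the unit complex has zero differential.
  have hx0 : (p.f 0).hom (((biprod.inr ≫ i).f 0).hom x) = 0 := by
    rw [← hv]
    refine (congrArg (fun t => t.hom v) (p.comm 1 0)).symm.trans ?_
    rw [hd, comp_zero]
    rfl
  have hx1 : (1 : k) = 0 := by
    have e := congrArg (unitForm k).hom.hom (hx.symm.trans hx0)
    have e' : (unitForm k).hom.hom x = (1 : k) :=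
      congrArg (fun t => t.hom (1 : k)) (unitForm k).inv_hom_id
    exact e'.symm.trans (e.trans (map_zero _))
  exact one_ne_zero hx1

/-- There is no model structure on the cogebras over an augmented operad with commutative
operations. -/
theorem CommData.not_coadmissible {P : Operad (Ch k)} (D : CommData P) : ¬ Coadmissible P := by
  rintro ⟨M, hW, hC, -⟩
  let U := 𝟙_ (Ch k)
  let j : Bool → (U ⟶ U ⊞ U) := fun b => if b then biprod.inr else biprod.inl
  let π : Bool → (U ⊞ U ⟶ U) := fun b => if b then biprod.snd else biprod.fst
  have hj : ∀ i l, j i ≫ π l = if i = l then 𝟙 U else 0 := by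
    rintro (_ | _) (_ | _) <;> simp [j, π]
  have total : ∑ i, π i ≫ j i = 𝟙 (U ⊞ U) := by
    rw [Fintype.sum_bool, add_comm]
    exact biprod.total
  have hj' : ∀ i l : Unit, (fun _ : Unit => 𝟙 U) i ≫ (fun _ : Unit => 𝟙 U) l =
      if i = l then 𝟙 U else 0 := fun i l => by simp
  have total' : ∑ i : Unit, (fun _ : Unit => 𝟙 U) i ≫ (fun _ : Unit => 𝟙 U) i = 𝟙 U := by simp
  let fold := pointsHom j π D hj total _ _ hj' total' (biprod.desc (𝟙 U) (𝟙 U)) (fun _ => ())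
    (by rintro (_ | _) <;> simp [j])
  -- The factorization into a cofibration and a trivial fibration; of the latter only the weak
  -- equivalence matters.
  obtain ⟨⟨Z, i, p, fac, hi, hp⟩⟩ := M.cm5b.nonempty_mapFactorizationData fold
  replace hi : cofib P i := hC ▸ hi
  have hp' : weakEquiv P p := hW ▸ hp.2
  have hδ (b : Bool) {δ₀ : U ⊞ U ⟶ (U ⊞ U) ⊗ (U ⊞ U)} {i₀ : U ⊞ U ⟶ Z.X}
      (hδ₀ : j b ≫ δ₀ = (λ_ U).inv ≫ (j b ⊗ₘ j b)) (hi₀ : i₀ ≫ D.δ Z = δ₀ ≫ (i₀ ⊗ₘ i₀)) :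
      (j b ≫ i₀) ≫ D.δ Z = (λ_ U).inv ≫ ((j b ≫ i₀) ⊗ₘ (j b ≫ i₀)) := by
    rw [Category.assoc, hi₀, reassoc_of% hδ₀, MonoidalCategory.tensorHom_comp_tensorHom]
  exact no_cylinder (D.δ Z) (D.δ_comm Z) (D.δ_assoc Z) i.hom p.hom (hi 0) hp'
    (congrArg Cogebra.Hom.hom fac)
    (hδ false (point_δ j π D hj total false) (D.hom_δ i))
    (hδ true (point_δ j π D hj total true) (D.hom_δ i))

end Main

end DG

theorem mainTheorem5 (k : Type*) [Field k] [IsAlgClosed k] [CharZero k] :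
    ¬ DG.Coadmissible (DG.uCom (DG.Ch k)) ∧ ¬ DG.Coadmissible (DG.Com (DG.Ch k)) :=
  ⟨DG.uComData.not_coadmissible, DG.comData.not_coadmissible⟩
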